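/- Let $k$ be a field, $V$ a finite-dimensional $k$-vector space, $F = T(V) = \bigoplus_{n\ge 0} F_n$ its tensor algebra with $F_n = V^{\otimes n}$, let $R \subset F_1 \oplus F_2 = V \oplus (V\otimes V)$ be a subspace with $R \cap V = 0$, let $I$ be the two-sided ideal of $F$ generated by $R$, and let $A \cong F/I$ (an almost quadratic algebra). Let $A^0$ be the graded algebra obtained as the quotient of $F$ by the two-sided ideal generated by the projection of $R$ on $F_2 = V\otimes V$. Let $\operatorname{gr} A = \bigoplus_{n\ge 0} A_{\le n}/A_{\le n-1}$ be the associated graded algebra of $A$ with respect to the filtration by degree, where $A_{\le n}$ is the image of $F_0\oplus\dots\oplus F_n$ in $A$ and $A_{\le -1} = 0$. Suppose that $A$ is PBW, that is, for some bases $v_1,\dots,v_n$ of $V$ and $r_1,\dots,r_m$ of $R$, the set $\{r_1,\dots,r_m\}$ is a Gröbner basis of $I$ with respect to the degree-lexicographical order on the words in $v_1 > \dots > v_n$ (the leading word of every nonzero element of $I$ contains the leading word of some $r_i$ as a subword). Then $A$ is Koszul in the sense of Priddy: $A^0$ and $\operatorname{gr} A$ are isomorphic as graded algebras, and both are Koszul.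 Here a graded algebra $B = \bigoplus_{n \ge 0} B_n$ with finite-dimensional components is called Koszul if $B_0 = k$, $B$ is generated by $B_1$, and $\operatorname{Tor}^B_i(k,k)$ is concentrated in internal degree $i$ for every $i\ge 0$. -/

import Mathlib

open scoped DirectSum TensorProduct

noncomputable section

namespace AlmostQuadratic

/-! ### The bar complex and homogeneous Koszul algebras -/

section Bar

variable {k B : Type*} [Field k] [Ring B] [Algebra k B]

/-- The `j`-th face of a word `(a₀, …, aₙ)`: the neighbours `aⱼ, aⱼ₊₁` are replaced by their
product. -/
def face {n : ℕ} (j : Fin n) (a : Fin (n + 1) → B) : Fin n → B :=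
  Fin.contractNth j.castSucc (· * ·) a

variable (k) in
lemma face_update {n : ℕ} [DecidableEq (Fin (n + 1))] (j : Fin n)
    (a : Fin (n + 1) → B) (p : Fin (n + 1)) :
    ∃ (q : Fin n) (φ : B →ₗ[k] B), ∀ x,
      face j (Function.update a p x) = Function.update (face j a) q (φ x) := by
  rcases lt_trichotomy (p : ℕ) j with h | h | h
  · refine ⟨⟨p, by omega⟩, LinearMap.id, fun x => funext fun i => ?_⟩
    simp only [face, Fin.contractNth, Function.update_apply, Fin.ext_iff, Fin.val_castSucc,
      Fin.val_succ, LinearMap.id_apply]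
    split_ifs <;> first | rfl | omega
  · refine ⟨j, LinearMap.mulRight k (a j.succ), fun x => funext fun i => ?_⟩
    simp only [face, Fin.contractNth, Function.update_apply, Fin.ext_iff, Fin.val_castSucc,
      Fin.val_succ, LinearMap.mulRight_apply]
    split_ifs <;> first | rfl | omega | (obtain rfl : i = j := Fin.ext (by omega); rfl)
  · by_cases h' : (p : ℕ) = j + 1
    · refine ⟨j, LinearMap.mulLeft k (a j.castSucc), fun x => funext fun i => ?_⟩
      simp only [face, Fin.contractNth, Function.update_apply, Fin.ext_iff, Fin.val_castSucc,
        Fin.val_succ, LinearMap.mulLeft_apply]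
      split_ifs <;> first | rfl | omega | (obtain rfl : i = j := Fin.ext (by omega); rfl)
    · refine ⟨⟨p - 1, by omega⟩, LinearMap.id, fun x => funext fun i => ?_⟩
      simp only [face, Fin.contractNth, Function.update_apply, Fin.ext_iff, Fin.val_castSucc,
        Fin.val_succ, LinearMap.id_apply]
      split_ifs <;> first | rfl | omega

/-- The multilinear map `(a₀, …, aₙ) ↦ a₀ ⊗ ⋯ ⊗ aⱼaⱼ₊₁ ⊗ ⋯ ⊗ aₙ`. -/
def faceMultilinear (k B : Type*) [Field k] [Ring B] [Algebra k B] {n : ℕ} (j : Fin n) :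
    MultilinearMap k (fun _ : Fin (n + 1) => B) (⨂[k] _ : Fin n, B) where
  toFun a := PiTensorProduct.tprod k (face j a)
  map_update_add' a p x y := by
    obtain ⟨q, φ, h⟩ := face_update k j a p
    simp only [h, map_add, MultilinearMap.map_update_add]
  map_update_smul' a p c x := by
    obtain ⟨q, φ, h⟩ := face_update k j a p
    simp only [h, map_smul, MultilinearMap.map_update_smul]

/-- The bar differential
`d (a₀ ⊗ ⋯ ⊗ aₙ) = ∑ⱼ (-1)ʲ a₀ ⊗ ⋯ ⊗ aⱼaⱼ₊₁ ⊗ ⋯ ⊗ aₙ`, where `0 ≤ j < n`. -/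
def barD (k B : Type*) [Field k] [Ring B] [Algebra k B] (n : ℕ) :
    (⨂[k] _ : Fin (n + 1), B) →ₗ[k] (⨂[k] _ : Fin n, B) :=
  ∑ j : Fin n, (-1 : k) ^ (j : ℕ) • PiTensorProduct.lift (faceMultilinear k B j)

/-- The component of homological degree `n` and internal degree `j` of the reduced bar complex
`(B₊)^{⊗ n}`, `B₊ = ⨁_{d > 0} 𝓑 d`, seen inside `B^{⊗ n}`: it is spanned by the tensors
`a₁ ⊗ ⋯ ⊗ aₙ` of homogeneous elements of positive degrees with sum `j`. -/
def bar (𝓑 : ℕ → Submodule k B) (n j : ℕ) : Submodule k (⨂[k] _ : Fin n, B) :=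
  Submodule.span k {t | ∃ (d : Fin n → ℕ) (a : Fin n → B),
    (∀ i, 0 < d i) ∧ ∑ i, d i = j ∧ (∀ i, a i ∈ 𝓑 (d i)) ∧ t = PiTensorProduct.tprod k a}

/-- The cycles of the reduced bar complex, of homological degree `n` and internal degree `j`. -/
def barCycles (𝓑 : ℕ → Submodule k B) : (n j : ℕ) → Submodule k (⨂[k] _ : Fin n, B)
  | 0, j => bar 𝓑 0 j
  | n + 1, j => bar 𝓑 (n + 1) j ⊓ LinearMap.ker (barD k B n)

/-- The boundaries of the reduced bar complex, of homological degree `n` and internal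
degree `j`. -/
def barBoundaries (𝓑 : ℕ → Submodule k B) (n j : ℕ) : Submodule k (⨂[k] _ : Fin n, B) :=
  (bar 𝓑 (n + 1) j).map (barD k B n)

/-- The component of internal degree `j` of `H_n B = Tor_n^B(k, k)` for a connected graded
algebra `B`, computed by the reduced bar complex. -/
abbrev TorComponent (𝓑 : ℕ → Submodule k B) (n j : ℕ) : Type _ :=
  barCycles 𝓑 n j ⧸ (barBoundaries 𝓑 n j).submoduleOf (barCycles 𝓑 n j)

/-- A standard algebra: a connected `ℕ`-graded algebra with finite-dimensional components which
is generated by its component of degree one. -/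
structure IsStandard (𝓑 : ℕ → Submodule k B) : Prop where
  one_mem : (1 : B) ∈ 𝓑 0
  mul_mem : ∀ (i j : ℕ) (x y : B), x ∈ 𝓑 i → y ∈ 𝓑 j → x * y ∈ 𝓑 (i + j)
  isInternal : DirectSum.IsInternal 𝓑
  finite : ∀ i, FiniteDimensional k (𝓑 i)
  nontrivial : Nontrivial B
  connected : 𝓑 0 = Submodule.span k {1}
  generated : Algebra.adjoin k (𝓑 1 : Set B) = ⊤

/-- A (homogeneous) Koszul algebra: a standard algebra `B` such that `H_n B = Tor_n^B(k, k)` is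
concentrated in internal degree `n`, for every `n`. -/
structure IsKoszul (𝓑 : ℕ → Submodule k B) : Prop extends IsStandard 𝓑 where
  tor_concentrated : ∀ n j : ℕ, j ≠ n → Subsingleton (TorComponent 𝓑 n j)

end Bar

/-! ### The associated graded algebra of the degree filtration -/

section Gr

variable {k A : Type*} [Field k] [Ring A] [Algebra k A]

/-- The filtration by degree defined by a space `W` of generators: the `n`-th term is spanned by
the products of at most `n` elements of `W`. -/
def filt (W : Submodule k A) (n : ℕ) : Submodule k A := (1 ⊔ W) ^ n

/-- The sum of the terms of the filtration of index less than `n`; it is `0` for `n = 0` and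
`filt W (n - 1)` otherwise. -/
def filtLT (W : Submodule k A) (n : ℕ) : Submodule k A := ⨆ (m : ℕ) (_ : m < n), filt W m

variable {W : Submodule k A}

lemma one_mem_filt : (1 : A) ∈ filt W 0 := by
  rw [filt, pow_zero]; exact Submodule.one_le.mp le_rfl

lemma mul_mem_filt {i j : ℕ} {x y : A} (hx : x ∈ filt W i) (hy : y ∈ filt W j) :
    x * y ∈ filt W (i + j) := by
  rw [filt, pow_add]; exact Submodule.mul_mem_mul hx hy

lemma filt_le_filtLT {m n : ℕ} (h : m < n) : filt W m ≤ filtLT W n :=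
  le_iSup₂_of_le m h le_rfl

lemma mul_mem_filtLT_left {i j : ℕ} {x y : A} (hx : x ∈ filtLT W i) (hy : y ∈ filt W j) :
    x * y ∈ filtLT W (i + j) := by
  have : filtLT W i ≤ (filtLT W (i + j)).comap (LinearMap.mulRight k y) :=
    iSup₂_le fun m hm z hz => filt_le_filtLT (by omega) (mul_mem_filt hz hy)
  exact this hx

lemma mul_mem_filtLT_right {i j : ℕ} {x y : A} (hx : x ∈ filt W i) (hy : y ∈ filtLT W j) :
    x * y ∈ filtLT W (i + j) := by
  have : filtLT W j ≤ (filtLT W (i + j)).comap (LinearMap.mulLeft k x) :=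
    iSup₂_le fun m hm z hz => filt_le_filtLT (by omega) (mul_mem_filt hx hz)
  exact this hy

variable (W) in
/-- The `n`-th component `F_n A / F_{n-1} A` of the associated graded algebra. -/
def GrComp (n : ℕ) : Type _ := filt W n ⧸ (filtLT W n).submoduleOf (filt W n)

instance (n : ℕ) : AddCommGroup (GrComp W n) :=
  inferInstanceAs (AddCommGroup (filt W n ⧸ (filtLT W n).submoduleOf (filt W n)))

instance (n : ℕ) : Module k (GrComp W n) :=
  inferInstanceAs (Module k (filt W n ⧸ (filtLT W n).submoduleOf (filt W n)))

variable (W) in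
/-- The class in `F_n A / F_{n-1} A` of an element of `F_n A`. -/
def symb (n : ℕ) : filt W n →ₗ[k] GrComp W n := ((filtLT W n).submoduleOf (filt W n)).mkQ

lemma symb_surjective (n : ℕ) : Function.Surjective (symb W n) := Submodule.mkQ_surjective _

lemma symb_eq_zero_iff {n : ℕ} (x : filt W n) : symb W n x = 0 ↔ (x : A) ∈ filtLT W n :=
  Submodule.Quotient.mk_eq_zero _

/-- Multiplication `F_i A → F_j A → F_{i+j} A`. -/
def filtMul (i j : ℕ) : filt W i →ₗ[k] filt W j →ₗ[k] filt W (i + j) :=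
  LinearMap.mk₂ k (fun x y => ⟨x * y, mul_mem_filt x.2 y.2⟩)
    (fun _ _ _ => Subtype.ext (add_mul _ _ _)) (fun _ _ _ => Subtype.ext (smul_mul_assoc _ _ _))
    (fun _ _ _ => Subtype.ext (mul_add _ _ _)) (fun _ _ _ => Subtype.ext (mul_smul_comm _ _ _))

/-- The product of the associated graded algebra, induced by the one of `A`. -/
def grMul (i j : ℕ) : GrComp W i →ₗ[k] GrComp W j →ₗ[k] GrComp W (i + j) :=
  Submodule.liftQ _
    (LinearMap.flip (Submodule.liftQ _
      (LinearMap.flip ((filtMul (W := W) i j).compr₂ (symb W (i + j))))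
      (fun y hy => LinearMap.ext fun x =>
        (symb_eq_zero_iff _).2 (mul_mem_filtLT_right x.2 hy))))
    (fun x hx => LinearMap.ext fun y => by
      obtain ⟨y, rfl⟩ := symb_surjective j y
      exact (symb_eq_zero_iff _).2 (mul_mem_filtLT_left hx y.2))

lemma grMul_symb {i j : ℕ} (x : filt W i) (y : filt W j) :
    grMul i j (symb W i x) (symb W j y) =
      symb W (i + j) ⟨x * y, mul_mem_filt x.2 y.2⟩ := rfl

lemma mk_symb_eq {i j : ℕ} (h : i = j) (x : filt W i) (y : filt W j) (hxy : (x : A) = y) :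
    GradedMonoid.mk (A := GrComp W) i (symb W i x) = GradedMonoid.mk j (symb W j y) := by
  subst h
  rw [Subtype.ext hxy]

/-- The unit of the associated graded algebra. -/
def grOne : GrComp W 0 := symb W 0 ⟨1, one_mem_filt⟩

instance : GradedMonoid.GMul (GrComp W) where mul x y := grMul _ _ x y

instance : GradedMonoid.GOne (GrComp W) where one := grOne

instance : DirectSum.GRing (GrComp W) where
  mul x y := grMul _ _ x y
  one := grOne
  mul_zero _ := map_zero _
  zero_mul _ := by simp
  mul_add _ _ _ := map_add _ _ _
  add_mul _ _ _ := by simp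
  one_mul := by
    rintro ⟨i, x⟩
    obtain ⟨x, rfl⟩ := symb_surjective i x
    exact mk_symb_eq (zero_add i) _ _ (one_mul _)
  mul_one := by
    rintro ⟨i, x⟩
    obtain ⟨x, rfl⟩ := symb_surjective i x
    exact mk_symb_eq (add_zero i) _ _ (mul_one _)
  mul_assoc := by
    rintro ⟨i, x⟩ ⟨j, y⟩ ⟨l, z⟩
    obtain ⟨x, rfl⟩ := symb_surjective i x
    obtain ⟨y, rfl⟩ := symb_surjective j y
    obtain ⟨z, rfl⟩ := symb_surjective l z
    exact mk_symb_eq (add_assoc i j l) _ _ (mul_assoc _ _ _)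
  natCast m := m • grOne
  natCast_zero := zero_smul _ _
  natCast_succ m := succ_nsmul _ _
  intCast m := m • grOne
  intCast_ofNat m := natCast_zsmul _ _
  intCast_negSucc_ofNat m := negSucc_zsmul _ _

instance : DirectSum.GAlgebra k (GrComp W) where
  toFun := (LinearMap.toSpanSingleton k (GrComp W 0) grOne).toAddMonoidHom
  map_one := one_smul k (grOne : GrComp W 0)
  map_mul r s := by
    refine mk_symb_eq (zero_add 0).symm ((r * s) • ⟨1, one_mem_filt⟩)
      ⟨(r • (1 : A)) * (s • (1 : A)), mul_mem_filt (Submodule.smul_mem _ _ one_mem_filt)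
        (Submodule.smul_mem _ _ one_mem_filt)⟩ ?_
    simp [mul_smul, smul_comm r s]
  commutes := by
    rintro r ⟨i, x⟩
    obtain ⟨x, rfl⟩ := symb_surjective i x
    refine mk_symb_eq (add_comm 0 i)
      ⟨(r • (1 : A)) * x, mul_mem_filt (Submodule.smul_mem _ _ one_mem_filt) x.2⟩
      ⟨x * (r • (1 : A)), mul_mem_filt x.2 (Submodule.smul_mem _ _ one_mem_filt)⟩ ?_
    simp
  smul_def := by
    rintro r ⟨i, x⟩
    obtain ⟨x, rfl⟩ := symb_surjective i x
    refine mk_symb_eq (zero_add i).symm (r • x)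
      ⟨(r • (1 : A)) * x, mul_mem_filt (Submodule.smul_mem _ _ one_mem_filt) x.2⟩ ?_
    simp

variable (W) in
/-- The associated graded algebra `gr A = ⨁ₙ F_n A / F_{n-1} A` of the filtration of `A` by
degree with respect to the space of generators `W`. -/
abbrev Gr : Type _ := ⨁ n, GrComp W n

variable (W) in
/-- The grading of `gr A`. -/
def grGrading (n : ℕ) : Submodule k (Gr W) :=
  LinearMap.range (DirectSum.lof k ℕ (GrComp W) n)

end Gr

/-! ### Almost quadratic algebras -/

section Presentation

variable {k V A : Type*} [Field k] [AddCommGroup V] [Module k V] [Ring A] [Algebra k A]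

variable (k V) in
/-- The component `F_n = V^{⊗ n}` of the tensor algebra `F = T(V)`. -/
abbrev tensorGrading (n : ℕ) : Submodule k (TensorAlgebra k V) :=
  LinearMap.range (TensorAlgebra.ι k : V →ₗ[k] TensorAlgebra k V) ^ n

/-- `π : T(V) → A` presents `A` as an almost quadratic algebra with the space of relations `R`:
`A = T(V) / (R)` with `R ⊆ V ⊕ V ⊗ V`. Generation by `V` is minimal in the sense that no relation
is linear, `R ∩ V = 0`. -/
structure IsAlmostQuadratic (π : TensorAlgebra k V →ₐ[k] A)
    (R : Submodule k (TensorAlgebra k V)) : Prop where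
  surjective : Function.Surjective π
  ker_eq : TwoSidedIdeal.ker π = TwoSidedIdeal.span (R : Set (TensorAlgebra k V))
  le : R ≤ tensorGrading k V 1 ⊔ tensorGrading k V 2
  inf_eq_bot : R ⊓ tensorGrading k V 1 = ⊥

/-- The quadratic parts of the relations: the projection of `R` on `V ⊗ V`. -/
def quadraticPart (R : Submodule k (TensorAlgebra k V)) : Submodule k (TensorAlgebra k V) :=
  R.map (GradedAlgebra.proj (tensorGrading k V) 2)

/-- The ideal of relations of `A⁰`. -/
def quadraticCon (R : Submodule k (TensorAlgebra k V)) : RingCon (TensorAlgebra k V) :=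
  (TwoSidedIdeal.span (quadraticPart R : Set (TensorAlgebra k V))).ringCon

/-- The quadratic algebra `A⁰`: the quotient of `T(V)` by the two-sided ideal generated by the
projection of `R` on `V ⊗ V`. -/
abbrev QuadraticAlg (R : Submodule k (TensorAlgebra k V)) : Type _ := (quadraticCon R).Quotient

/-- The grading of `A⁰` induced by the one of `T(V)`. -/
def quadraticGrading (R : Submodule k (TensorAlgebra k V)) (n : ℕ) :
    Submodule k (QuadraticAlg R) :=
  (tensorGrading k V n).map ((quadraticCon R).mkₐ k).toLinearMap

/-- The image of `V` in `A`. -/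
def generators (π : TensorAlgebra k V →ₐ[k] A) : Submodule k A :=
  LinearMap.range (π.toLinearMap ∘ₗ TensorAlgebra.ι k)

/-- Koszulity in Priddy's sense: `A⁰` and `gr A` are isomorphic as graded algebras and both of
them are Koszul. -/
structure IsPriddyKoszul (π : TensorAlgebra k V →ₐ[k] A)
    (R : Submodule k (TensorAlgebra k V)) : Prop where
  iso : ∃ e : QuadraticAlg R ≃ₐ[k] Gr (generators π),
    ∀ n, (quadraticGrading R n).map e.toLinearMap = grGrading (generators π) n
  koszul_quadratic : IsKoszul (quadraticGrading R)
  koszul_gr : IsKoszul (grGrading (generators π))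

/-! ### Gröbner bases and PBW algebras -/

/-- The strict degree-lexicographical order on words in the letters `v₀ > v₁ > ⋯ > vₙ₋₁`. -/
def DegLexLT {n : ℕ} (u w : FreeMonoid (Fin n)) : Prop :=
  List.Shortlex (fun i j : Fin n => j < i) u.toList w.toList

/-- `w` is the leading monomial of `f ∈ T(V)`, expanded in the words in the basis `b` of `V`. -/
def IsLeadingWord {n : ℕ} (b : Module.Basis (Fin n) k V) (f : TensorAlgebra k V)
    (w : FreeMonoid (Fin n)) : Prop :=
  b.tensorAlgebra.repr f w ≠ 0 ∧
    ∀ u, b.tensorAlgebra.repr f u ≠ 0 → u ≠ w → DegLexLT u w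

/-- `G` is a Gröbner basis of `I`: `G ⊆ I`, and the leading monomial of each nonzero element of `I`
contains the leading monomial of an element of `G` as a subword. -/
def IsGroebnerBasis {n : ℕ} (b : Module.Basis (Fin n) k V) (G : Set (TensorAlgebra k V))
    (I : TwoSidedIdeal (TensorAlgebra k V)) : Prop :=
  (∀ g ∈ G, g ∈ I) ∧ ∀ f ∈ I, ∀ w, IsLeadingWord b f w →
    ∃ g ∈ G, ∃ u, IsLeadingWord b g u ∧ u.toList <:+: w.toList

/-- The PBW property: for some bases of `V` and `R`, the basis of `R` is a Gröbner basis of the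
ideal of relations. -/
def IsPBW (R : Submodule k (TensorAlgebra k V)) : Prop :=
  ∃ (n : ℕ) (b : Module.Basis (Fin n) k V) (m : ℕ) (r : Module.Basis (Fin m) k R),
    IsGroebnerBasis b (Set.range fun i => (r i : TensorAlgebra k V))
      (TwoSidedIdeal.span (R : Set (TensorAlgebra k V)))

end Presentation

end AlmostQuadratic

end

/-! Call a word normal if no two consecutive letters form the leading word of an element of `R`.
Since `R ∩ V = 0`, every such leading word has length two. Normal words then give compatible bases
of `A⁰` and `gr A`.

Spanning: modulo the quadratic parts of the relations, a non-normal word is a combination of smaller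
words of the same length, so by induction the normal words span `A⁰` (`mk_mem_span_isLowerOrEq`).
The quadratic part of a relation has zero symbol, being equal in `A` to a linear element, so there
is a surjection `A⁰ → gr A`. Independence: if a combination of normal words vanishes in `gr A`, its
part of the length of its leading word agrees in `A` with a combination of shorter words. The
difference lies in the ideal and has a normal leading word, which the Gröbner property forbids
(`eq_zero_of_toGr_eq_zero`). So the surjection is an isomorphism, and the normal words form a basis
of both algebras in which a product is the concatenation, or a combination of smaller words when
that is not normal (`IsPBWBasis`).

Koszulity follows from such a basis alone. Filter the bar complex by the word obtained by
concatenating all factors. To leading order the differential only removes bars at which the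
concatenation remains normal, as for a monomial algebra. There an explicit `homotopy` `h` contracts
everything except tuples of single letters, so off the diagonal `dh + hd - id` strictly lowers the
concatenated word (`homotopy_formula`). Words of a given length being finite in number, induction
makes every off-diagonal cycle a boundary (`exists_tensorBarD_eq`). -/

noncomputable section

namespace AlmostQuadratic

/-! ### Words in a basis as a basis of the tensor algebra -/

section WordBasis

open TensorAlgebra (ι)

variable {k M N : Type*} [Field k] [AddCommGroup M] [Module k M] (b : Module.Basis N k M)

/-- The basis of `T(M)` formed by the words in a basis of `M`, indexed by lists. -/
def wordBasis : Module.Basis (List N) k (TensorAlgebra k M) :=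
  b.tensorAlgebra.reindex FreeMonoid.toList

lemma wordBasis_eq_prod (l : List N) :
    wordBasis b l = (l.map fun i => ι k (b i)).prod := by
  have h : wordBasis b l = (TensorAlgebra.equivFreeAlgebra b).symm
      (FreeAlgebra.equivMonoidAlgebraFreeMonoid.symm
        (MonoidAlgebra.single (FreeMonoid.ofList l) 1)) := by
    simp [wordBasis, Module.Basis.tensorAlgebra, FreeAlgebra.basisFreeMonoid]
  have h' : FreeAlgebra.equivMonoidAlgebraFreeMonoid.symm
      (MonoidAlgebra.single (FreeMonoid.ofList l) (1 : k)) =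
      (l.map (FreeAlgebra.ι k)).prod := by
    rw [FreeAlgebra.equivMonoidAlgebraFreeMonoid]
    exact (MonoidAlgebra.lift_single _ _ _).trans (by simp [FreeMonoid.lift_apply])
  rw [h, h', map_list_prod, List.map_map]
  congr 1
  exact List.map_congr_left fun i _ => TensorAlgebra.equivFreeAlgebra_symm_ι b i

@[simp]
lemma wordBasis_nil : wordBasis b [] = 1 := by simp [wordBasis_eq_prod]

lemma wordBasis_cons (i : N) (l : List N) :
    wordBasis b (i :: l) = ι k (b i) * wordBasis b l := by simp [wordBasis_eq_prod]

lemma wordBasis_append (l l' : List N) :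
    wordBasis b (l ++ l') = wordBasis b l * wordBasis b l' := by simp [wordBasis_eq_prod]

end WordBasis

/-! ### The bar differential on the tensor algebra -/

section TensorBar

open TensorAlgebra (ι)

variable {k B N : Type*} [Field k] [Ring B] [Algebra k B] (b : Module.Basis N k B)

/-- Multiplication of the first tensor factor by `a` on the left: `x ⊗ t ↦ a x ⊗ t`; it kills the
component of degree zero. -/
def mulHead : B →ₗ[k] TensorAlgebra k B →ₗ[k] TensorAlgebra k B :=
  LinearMap.flip ((wordBasis b).constr k fun l => match l with
    | [] => 0
    | i :: l => LinearMap.mulRight k (wordBasis b l) ∘ₗ ι k ∘ₗ LinearMap.mulRight k (b i))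

@[simp]
lemma mulHead_one (a : B) : mulHead b a 1 = 0 := by
  rw [← wordBasis_nil b, mulHead, LinearMap.flip_apply, Module.Basis.constr_basis]; rfl

lemma mulHead_ι_mul (a x : B) (t : TensorAlgebra k B) :
    mulHead b a (ι k x * t) = ι k (a * x) * t := by
  have : (LinearMap.mul k _).compr₂ (mulHead b a) ∘ₗ ι k =
      LinearMap.mul k (TensorAlgebra k B) ∘ₗ ι k ∘ₗ LinearMap.mulLeft k a := by
    refine b.ext fun i => (wordBasis b).ext fun l => ?_
    simp only [LinearMap.comp_apply, LinearMap.compr₂_apply, LinearMap.mul_apply', ← wordBasis_cons,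
      LinearMap.mulLeft_apply]
    rw [mulHead, LinearMap.flip_apply, Module.Basis.constr_basis]; rfl
  exact LinearMap.congr_fun (LinearMap.congr_fun this x) t

/-- The bar differential of a word in the basis of `B`. -/
def tensorBarWord : List N → TensorAlgebra k B
  | [] => 0
  | i :: l => mulHead b (b i) (wordBasis b l) - ι k (b i) * tensorBarWord l

/-- The bar differential on `T(B)`. -/
def tensorBarD : TensorAlgebra k B →ₗ[k] TensorAlgebra k B :=
  (wordBasis b).constr k (tensorBarWord b)

@[simp]
lemma tensorBarD_one : tensorBarD b 1 = 0 := by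
  rw [← wordBasis_nil b, tensorBarD, Module.Basis.constr_basis]; rfl

lemma tensorBarD_ι_mul (a : B) (t : TensorAlgebra k B) :
    tensorBarD b (ι k a * t) = mulHead b a t - ι k a * tensorBarD b t := by
  have : (LinearMap.mul k _).compr₂ (tensorBarD b) ∘ₗ ι k =
      mulHead b - (LinearMap.mul k _ ∘ₗ ι k).compl₂ (tensorBarD b) := by
    refine b.ext fun i => (wordBasis b).ext fun l => ?_
    simp only [LinearMap.comp_apply, LinearMap.compr₂_apply, LinearMap.mul_apply', ← wordBasis_cons,
      LinearMap.sub_apply, LinearMap.compl₂_apply]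
    simp only [tensorBarD, Module.Basis.constr_basis]; rfl
  exact LinearMap.congr_fun (LinearMap.congr_fun this a) t

lemma mulHead_mulHead (a x : B) (t : TensorAlgebra k B) :
    mulHead b a (mulHead b x t) = mulHead b (a * x) t := by
  have : mulHead b a ∘ₗ mulHead b x = mulHead b (a * x) := by
    refine (wordBasis b).ext fun l => ?_
    cases l with
    | nil => simp
    | cons i l => simp [wordBasis_cons, mulHead_ι_mul, mul_assoc]
  exact LinearMap.congr_fun this t

lemma tensorBarD_mulHead (a : B) (t : TensorAlgebra k B) :
    tensorBarD b (mulHead b a t) = mulHead b a (tensorBarD b t) := by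
  have : tensorBarD b ∘ₗ mulHead b a = mulHead b a ∘ₗ tensorBarD b := by
    refine (wordBasis b).ext fun l => ?_
    cases l with
    | nil => simp
    | cons i l => simp [wordBasis_cons, mulHead_ι_mul, tensorBarD_ι_mul, mulHead_mulHead]
  exact LinearMap.congr_fun this t

/-- Writing `a · t` for `mulHead b a t`, expanding `d` twice on `a ⊗ t` leaves `d (a · t) - a · d
t`, which is zero by `tensorBarD_mulHead` (associativity in `B`), and `a ⊗ d (d t)`, zero by
induction on the number of factors. -/
lemma tensorBarD_tensorBarD (t : TensorAlgebra k B) : tensorBarD b (tensorBarD b t) = 0 := by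
  have : tensorBarD b ∘ₗ tensorBarD b = 0 := by
    refine (wordBasis b).ext fun l => ?_
    induction l with
    | nil => simp
    | cons i l ih =>
      simp only [LinearMap.comp_apply, LinearMap.zero_apply] at ih
      simp [wordBasis_cons, tensorBarD_ι_mul, tensorBarD_mulHead, ih]
  exact LinearMap.congr_fun this t

/-- `T(B)` is the direct sum of the tensor powers. Injectivity brings identities proved in `T(B)`,
where recursion on the first factor is available, back to the bar complex. -/
lemma toTensorAlgebra_injective (n : ℕ) :
    Function.Injective (TensorPower.toTensorAlgebra : (⨂[k] _ : Fin n, B) →ₗ[k] _) := by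
  intro x y h
  have h' : ∀ z : (⨂[k]^n) B, TensorAlgebra.ofDirectSum (DirectSum.of _ n z) =
      TensorPower.toTensorAlgebra z := fun z =>
    DirectSum.toAddMonoid_of (fun _ ↦ LinearMap.toAddMonoidHom TensorPower.toTensorAlgebra) _ _
  have h'' := congrArg TensorAlgebra.toDirectSum ((h' x).trans (h.trans (h' y).symm))
  rw [TensorAlgebra.toDirectSum_ofDirectSum, TensorAlgebra.toDirectSum_ofDirectSum] at h''
  exact DirectSum.of_injective n h''

lemma tprod_succ {n : ℕ} (a : Fin (n + 1) → B) :
    TensorAlgebra.tprod k B (n + 1) a = ι k (a 0) * TensorAlgebra.tprod k B n (Fin.tail a) := by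
  simp [TensorAlgebra.tprod_apply, List.ofFn_succ, Fin.tail]

lemma toTensorAlgebra_barD_tprod (n : ℕ) (a : Fin (n + 1) → B) :
    TensorPower.toTensorAlgebra (barD k B n (PiTensorProduct.tprod k a)) =
      ∑ j : Fin n, (-1 : k) ^ (j : ℕ) • TensorAlgebra.tprod k B n (face j a) := by
  simp only [barD, LinearMap.sum_apply, LinearMap.smul_apply, PiTensorProduct.lift.tprod, map_sum,
    map_smul]
  exact Finset.sum_congr rfl fun j _ => congrArg _ (TensorPower.toTensorAlgebra_tprod _)

lemma face_zero {n : ℕ} (a : Fin (n + 2) → B) :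
    face 0 a = Fin.cons (a 0 * a 1) (Fin.tail (Fin.tail a)) := by
  funext i
  refine Fin.cases ?_ (fun i => ?_) i
  · simp [face, Fin.contractNth]
  · simp [face, Fin.contractNth, Fin.tail]

lemma face_succ {n : ℕ} (j : Fin n) (a : Fin (n + 2) → B) :
    face j.succ a = Fin.cons (a 0) (face j (Fin.tail a)) := by
  funext i
  refine Fin.cases ?_ (fun i => ?_) i
  · simp [face, Fin.contractNth]
  · simp [face, Fin.contractNth, Fin.tail]

/-- Face `0` is the term `mulHead`. The faces `j + 1` keep the first factor and come from the
recursive term, whose minus sign raises the exponent of `-1` by one. -/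
lemma tensorBarD_tprod (n : ℕ) (a : Fin (n + 1) → B) :
    tensorBarD b (TensorAlgebra.tprod k B (n + 1) a) =
      ∑ j : Fin n, (-1 : k) ^ (j : ℕ) • TensorAlgebra.tprod k B n (face j a) := by
  induction n with
  | zero => 
    rw [tprod_succ, tensorBarD_ι_mul]; simp [TensorAlgebra.tprod_apply]
  | succ n ih =>
    rw [tprod_succ, tensorBarD_ι_mul, ih, Fin.sum_univ_succ, face_zero, tprod_succ (Fin.tail a),
      mulHead_ι_mul, tprod_succ]
    simp only [face_succ, tprod_succ (Fin.cons _ _), Fin.cons_zero, Fin.tail_cons]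
    simp [pow_succ, Finset.mul_sum, sub_eq_add_neg, Fin.tail]

lemma toTensorAlgebra_barD (n : ℕ) (x : ⨂[k] _ : Fin (n + 1), B) :
    TensorPower.toTensorAlgebra (barD k B n x) = tensorBarD b (TensorPower.toTensorAlgebra x) := by
  have : (TensorPower.toTensorAlgebra : (⨂[k] _ : Fin n, B) →ₗ[k] _) ∘ₗ barD k B n =
      tensorBarD b ∘ₗ TensorPower.toTensorAlgebra := by
    refine PiTensorProduct.ext (MultilinearMap.ext fun a => ?_)
    simp only [LinearMap.compMultilinearMap_apply, LinearMap.comp_apply]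
    rw [toTensorAlgebra_barD_tprod, TensorPower.toTensorAlgebra_tprod, tensorBarD_tprod]
  exact LinearMap.congr_fun this x

end TensorBar

/-! ### The degree-lexicographical order -/

section WordOrder

variable {X : Type*} [LinearOrder X]

/-- The degree-lexicographical order on words, larger letters being the smaller ones of `X`. -/
def WordLT (u w : List X) : Prop := List.Shortlex (fun i j : X => j < i) u w

/-- `u` is smaller than `w` and of the same length. -/
def IsLower (w u : List X) : Prop := u.length = w.length ∧ WordLT u w

lemma isLower_iff_lex {w u : List X} :
    IsLower w u ↔ u.length = w.length ∧ List.Lex (fun i j : X => j < i) u w :=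
  and_congr_right fun h => List.shortlex_iff_lex h

/-- Equal lengths exclude the case of a proper prefix, in which appending could reverse the
comparison. -/
lemma lex_append_right {u w : List X} (h : List.Lex (fun i j : X => j < i) u w)
    (hl : u.length = w.length) (s : List X) :
    List.Lex (fun i j : X => j < i) (u ++ s) (w ++ s) := by
  induction h with
  | nil => simp at hl
  | cons _ ih => exact List.Lex.cons (ih (by simpa using hl))
  | rel h => exact List.Lex.rel h

lemma IsLower.append_left {w u : List X} (h : IsLower w u) (p : List X) :
    IsLower (p ++ w) (p ++ u) :=
  ⟨by simp [h.1], List.Shortlex.append_left h.2 p⟩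

lemma IsLower.append_right {w u : List X} (h : IsLower w u) (s : List X) :
    IsLower (w ++ s) (u ++ s) := by
  rw [isLower_iff_lex] at h ⊢
  exact ⟨by simp [h.1], lex_append_right h.2 h.1 s⟩

lemma WordLT.irrefl (u : List X) : ¬ WordLT u u := fun h =>
  (List.Shortlex.asymm (r := fun i j : X => j < i)).asymm _ _ h h

lemma lex_trans {u v w : List X} (h : List.Lex (fun i j : X => j < i) u v)
    (h' : List.Lex (fun i j : X => j < i) v w) : List.Lex (fun i j : X => j < i) u w := by
  induction h generalizing w with
  | nil => cases h' <;> exact List.Lex.nil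
  | cons _ ih =>
    cases h' with
    | cons h' => exact List.Lex.cons (ih h')
    | rel h' => exact List.Lex.rel h'
  | rel h =>
    cases h' with
    | cons h' => exact List.Lex.rel h
    | rel h' => exact List.Lex.rel (h'.trans h)

lemma WordLT.trans {u v w : List X} (h : WordLT u v) (h' : WordLT v w) : WordLT u w := by
  rw [WordLT, List.shortlex_def] at *
  rcases h with h | h <;> rcases h' with h' | h'
  · exact .inl (h.trans h')
  · exact .inl (by omega)
  · exact .inl (by omega)
  · exact .inr ⟨h.1.trans h'.1, lex_trans h.2 h'.2⟩

lemma IsLower.trans {u v w : List X} (h : IsLower v u) (h' : IsLower w v) : IsLower w u :=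
  ⟨h.1.trans h'.1, h.2.trans h'.2⟩

lemma WordLT.trichotomous {u w : List X} (h : u ≠ w) : WordLT u w ∨ WordLT w u := by
  by_contra! hn
  exact h ((List.Shortlex.trichotomous (r := fun i j : X => j < i)).trichotomous u w hn.1 hn.2)

/-- The number of words of the same length which are smaller than a given one. -/
def wordRank (w : List X) : ℕ := {u | IsLower w u}.ncard

lemma finite_isLower [Finite X] (w : List X) : {u | IsLower w u}.Finite :=
  (List.finite_length_eq X w.length).subset fun _ h => h.1

lemma IsLower.wordRank_lt [Finite X] {w u : List X} (h : IsLower w u) : wordRank u < wordRank w :=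
  Set.ncard_lt_ncard ⟨fun _ hv => IsLower.trans hv h, fun h' => WordLT.irrefl u (h' h).2⟩
    (finite_isLower w)

lemma isLower_induction [Finite X] {P : List X → Prop}
    (ind : ∀ w, (∀ u, IsLower w u → P u) → P w) (w : List X) : P w := by
  induction hr : wordRank w using Nat.strong_induction_on generalizing w with
  | _ r ih => exact ind w fun u hu => ih _ (hr ▸ hu.wordRank_lt) u rfl

/-- A nonempty finite set of words has a greatest element. -/
lemma exists_greatest_word (s : Finset (List X)) (hs : s.Nonempty) :
    ∃ w ∈ s, ∀ u ∈ s, u ≠ w → WordLT u w := by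
  induction hs using Finset.Nonempty.cons_induction with
  | singleton a => exact ⟨a, by simp, by simp⟩
  | cons a s ha hs ih =>
    obtain ⟨w, hw, h⟩ := ih
    rcases WordLT.trichotomous (u := a) (w := w) (by rintro rfl; exact ha hw) with h' | h'
    · refine ⟨w, by simp [hw], fun u hu hne => ?_⟩
      rcases Finset.mem_cons.1 hu with rfl | hu
      exacts [h', h u hu hne]
    · refine ⟨a, by simp, fun u hu hne => ?_⟩
      have hu := (Finset.mem_cons.1 hu).resolve_left hne
      by_cases huw : u = w
      · exact huw ▸ h'
      · exact (h u hu huw).trans h'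

end WordOrder

/-! ### PBW bases -/

section PBWBasis

open TensorAlgebra (ι)

variable {X : Type*}

/-- The words without two consecutive letters in the relation `S`. -/
def IsNormal (S : X → X → Prop) (w : List X) : Prop := w.IsChain fun x y => ¬ S x y

/-- The type of normal words. -/
abbrev NormalWord (S : X → X → Prop) : Type _ := {w : List X // IsNormal S w}

variable {S : X → X → Prop}

lemma isNormal_cons_cons {x y : X} {w : List X} :
    IsNormal S (x :: y :: w) ↔ ¬ S x y ∧ IsNormal S (y :: w) := List.isChain_cons_cons

/-- The word of one letter. -/
def letter (S : X → X → Prop) (x : X) : NormalWord S := ⟨[x], List.isChain_singleton x⟩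

/-- The empty word. -/
def emptyWord (S : X → X → Prop) : NormalWord S := ⟨[], List.isChain_nil⟩

/-- The concatenation of a list of normal words. -/
def cat (l : List (NormalWord S)) : List X := (l.map Subtype.val).flatten

@[simp] lemma cat_nil : cat ([] : List (NormalWord S)) = [] := rfl

@[simp] lemma cat_cons (u : NormalWord S) (l : List (NormalWord S)) :
    cat (u :: l) = u.1 ++ cat l := rfl

variable {k B : Type*} [Field k] [Ring B] [Algebra k B]

/-- The span of the words of `n` letters in the nonempty elements of the basis `b` with
concatenation satisfying `Q`. -/
def barSpan (b : Module.Basis (NormalWord S) k B) (n : ℕ) (Q : List X → Prop) :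
    Submodule k (TensorAlgebra k B) :=
  Submodule.span k (wordBasis b '' {l | l.length = n ∧ (∀ u ∈ l, u.1 ≠ []) ∧ Q (cat l)})

variable {b : Module.Basis (NormalWord S) k B} {n : ℕ} {P Q Q' : List X → Prop}

lemma wordBasis_mem_barSpan {l : List (NormalWord S)} (hl : l.length = n)
    (hne : ∀ u ∈ l, u.1 ≠ []) (hQ : Q (cat l)) : wordBasis b l ∈ barSpan b n Q :=
  Submodule.subset_span ⟨l, ⟨hl, hne, hQ⟩, rfl⟩

lemma barSpan_le_comap {f : TensorAlgebra k B →ₗ[k] TensorAlgebra k B}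
    {M : Submodule k (TensorAlgebra k B)}
    (h : ∀ l : List (NormalWord S), l.length = n → (∀ u ∈ l, u.1 ≠ []) → Q (cat l) →
      f (wordBasis b l) ∈ M) {t : TensorAlgebra k B} (ht : t ∈ barSpan b n Q) : f t ∈ M := by
  have : barSpan b n Q ≤ M.comap f := by
    refine Submodule.span_le.2 ?_
    rintro _ ⟨l, ⟨h1, h2, h3⟩, rfl⟩
    exact h l h1 h2 h3
  exact this ht

lemma barSpan_mono (h : ∀ w, Q w → Q' w) : barSpan b n Q ≤ barSpan b n Q' :=
  Submodule.span_mono (Set.image_mono fun _ hl => ⟨hl.1, hl.2.1, h _ hl.2.2⟩)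

lemma ι_mul_mem_barSpan {a : B} {t : TensorAlgebra k B}
    (ha : a ∈ Submodule.span k (b '' {u | u.1 ≠ [] ∧ P u.1})) (ht : t ∈ barSpan b n Q)
    (h : ∀ u w, P u → Q w → Q' (u ++ w)) : ι k a * t ∈ barSpan b (n + 1) Q' := by
  have : Submodule.span k (b '' {u | u.1 ≠ [] ∧ P u.1}) ≤
      (barSpan b (n + 1) Q').comap (LinearMap.mulRight k t ∘ₗ ι k) := by
    refine Submodule.span_le.2 ?_
    rintro _ ⟨u, ⟨hu, hP⟩, rfl⟩
    change LinearMap.mulLeft k (ι k (b u)) t ∈ barSpan b (n + 1) Q'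
    refine barSpan_le_comap (fun l h1 h2 h3 => ?_) ht
    rw [LinearMap.mulLeft_apply, ← wordBasis_cons]
    exact wordBasis_mem_barSpan (by simp [h1]) (List.forall_mem_cons.2 ⟨hu, h2⟩) (h _ _ hP h3)
  exact this ha

lemma ι_basis_mul_mem_barSpan {u : NormalWord S} {t : TensorAlgebra k B} (hu : u.1 ≠ [])
    (ht : t ∈ barSpan b n Q) (h : ∀ w, Q w → Q' (u.1 ++ w)) :
    ι k (b u) * t ∈ barSpan b (n + 1) Q' :=
  ι_mul_mem_barSpan (P := fun v => v = u.1) (Submodule.subset_span ⟨u, ⟨hu, rfl⟩, rfl⟩) ht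
    (by rintro _ w rfl hw; exact h w hw)

open Classical in
variable (b) in
/-- The contracting homotopy of the bar complex, on words in the basis `b`: it splits off the first
letter of the first factor of length at least two, provided that no earlier place between two
factors could be closed. -/
def homotopyWord : List (NormalWord S) → TensorAlgebra k B
  | [] => 0
  | ⟨[], _⟩ :: _ => 0
  | ⟨[x], _⟩ :: l =>
    if ∃ y ∈ (cat l).head?, S x y then -(ι k (b (letter S x)) * homotopyWord l) else 0
  | ⟨x :: y :: w, h⟩ :: l =>
    ι k (b (letter S x)) * (ι k (b ⟨y :: w, (isNormal_cons_cons.1 h).2⟩) * wordBasis b l)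

open Classical in
lemma homotopyWord_letter (x : X) (l : List (NormalWord S)) :
    homotopyWord b (letter S x :: l) = if ∃ y ∈ (cat l).head?, S x y then
      -(ι k (b (letter S x)) * homotopyWord b l) else 0 := by
  conv_lhs => unfold letter homotopyWord

variable (b) in
/-- The contracting homotopy of the bar complex. -/
def homotopy : TensorAlgebra k B →ₗ[k] TensorAlgebra k B :=
  (wordBasis b).constr k (homotopyWord b)

lemma homotopy_wordBasis (l : List (NormalWord S)) :
    homotopy b (wordBasis b l) = homotopyWord b l := Module.Basis.constr_basis _ _ _ _

lemma homotopy_ι_mul {x y : X} {w : List X} (h : IsNormal S (x :: y :: w))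
    (t : TensorAlgebra k B) :
    homotopy b (ι k (b ⟨x :: y :: w, h⟩) * t) =
      ι k (b (letter S x)) * (ι k (b ⟨y :: w, (isNormal_cons_cons.1 h).2⟩) * t) := by
  have : homotopy b ∘ₗ LinearMap.mulLeft k (ι k (b ⟨x :: y :: w, h⟩)) =
      LinearMap.mulLeft k (ι k (b (letter S x))) ∘ₗ
        LinearMap.mulLeft k (ι k (b ⟨y :: w, (isNormal_cons_cons.1 h).2⟩)) := by
    refine (wordBasis b).ext fun l => ?_
    simp only [LinearMap.comp_apply, LinearMap.mulLeft_apply]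
    rw [← wordBasis_cons, homotopy_wordBasis, homotopyWord]
  exact LinearMap.congr_fun this t

/-- After a single letter, the branch taken by the homotopy depends only on the first letter of the
remaining concatenation. It is therefore constant on the span of all tuples with one fixed
concatenation, in particular on the leading part of a differential. -/
lemma homotopy_letter_of_rel {x y : X} {w : List X} (hxy : S x y) {t : TensorAlgebra k B}
    (ht : t ∈ barSpan b n (· = y :: w)) :
    homotopy b (ι k (b (letter S x)) * t) = -(ι k (b (letter S x)) * homotopy b t) := by
  refine LinearMap.eqOn_span (f := homotopy b ∘ₗ LinearMap.mulLeft k (ι k (b (letter S x))))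
    (g := -(LinearMap.mulLeft k (ι k (b (letter S x))) ∘ₗ homotopy b)) ?_ ht
  rintro _ ⟨l, ⟨-, -, h3⟩, rfl⟩
  simp only [LinearMap.comp_apply, LinearMap.mulLeft_apply, LinearMap.neg_apply]
  rw [← wordBasis_cons, homotopy_wordBasis, homotopyWord_letter,
    if_pos ⟨y, by simp [h3], hxy⟩, homotopy_wordBasis]

lemma homotopy_letter_of_not_rel {x y : X} {w : List X} (hxy : ¬ S x y) {t : TensorAlgebra k B}
    (ht : t ∈ barSpan b n (· = y :: w)) :
    homotopy b (ι k (b (letter S x)) * t) = 0 := by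
  refine LinearMap.eqOn_span (f := homotopy b ∘ₗ LinearMap.mulLeft k (ι k (b (letter S x))))
    (g := 0) ?_ ht
  rintro _ ⟨l, ⟨-, -, h3⟩, rfl⟩
  simp only [LinearMap.comp_apply, LinearMap.mulLeft_apply, LinearMap.zero_apply]
  rw [← wordBasis_cons, homotopy_wordBasis, homotopyWord_letter, if_neg]
  simpa [h3] using hxy

lemma homotopyWord_mem_barSpan {l : List (NormalWord S)} (hl : ∀ v ∈ l, v.1 ≠ []) :
    homotopyWord b l ∈ barSpan b (l.length + 1) (· = cat l) := by
  induction l with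
  | nil => simp [homotopyWord]
  | cons u l ih =>
    have hl' : ∀ v ∈ l, v.1 ≠ [] := fun x hx => hl x (by simp [hx])
    rcases u with ⟨_ | ⟨x, _ | ⟨y, w⟩⟩, h⟩
    · simp [homotopyWord]
    · rw [homotopyWord]
      split_ifs
      · refine Submodule.neg_mem _ (ι_basis_mul_mem_barSpan (by simp [letter]) (ih hl') ?_)
        rintro _ rfl
        rfl
      · simp
    · rw [homotopyWord, ← wordBasis_cons, ← wordBasis_cons]
      exact wordBasis_mem_barSpan (by simp) (by simpa [letter] using hl') rfl

lemma homotopy_mem_barSpan {t : TensorAlgebra k B} (ht : t ∈ barSpan b n Q) :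
    homotopy b t ∈ barSpan b (n + 1) Q := by
  refine barSpan_le_comap (fun l h1 h2 h3 => ?_) ht
  rw [homotopy_wordBasis, ← h1]
  exact barSpan_mono (by rintro _ rfl; exact h3) (homotopyWord_mem_barSpan h2)

variable [LinearOrder X]

/-- A basis of an algebra, indexed by the words which are normal with respect to a set `S` of pairs
of letters, such that products of basis elements are concatenations up to smaller words. -/
structure IsPBWBasis (b : Module.Basis (NormalWord S) k B) : Prop where
  one : b (emptyWord S) = 1
  mul_of_isNormal : ∀ (u v : NormalWord S) (h : IsNormal S (u.1 ++ v.1)),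
    b u * b v = b ⟨u.1 ++ v.1, h⟩
  mul_of_not_isNormal : ∀ u v : NormalWord S, ¬ IsNormal S (u.1 ++ v.1) →
    b u * b v ∈ Submodule.span k (b '' {w | IsLower (u.1 ++ v.1) w.1})

/-- `u` is equal to `w`, or smaller and of the same length. -/
def IsLowerOrEq (w u : List X) : Prop := u = w ∨ IsLower w u

lemma exists_add_of_mem_barSpan_isLowerOrEq {w : List X} {t : TensorAlgebra k B}
    (ht : t ∈ barSpan b n (IsLowerOrEq w)) :
    ∃ y ∈ barSpan b n (· = w), ∃ z ∈ barSpan b n (IsLower w), y + z = t := by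
  refine Submodule.mem_sup.1 ((?_ : barSpan b n (IsLowerOrEq w) ≤ _) ht)
  refine Submodule.span_le.2 ?_
  rintro _ ⟨l, ⟨h1, h2, h3 | h3⟩, rfl⟩
  · exact Submodule.mem_sup_left (wordBasis_mem_barSpan h1 h2 h3)
  · exact Submodule.mem_sup_right (wordBasis_mem_barSpan h1 h2 h3)

namespace IsPBWBasis

/-- Smaller words have the same length as `u ++ v`, so they are nonempty and the reduced bar complex
is preserved. -/
lemma mul_mem_isLower (hb : IsPBWBasis b)
    {u v : NormalWord S} (hu : u.1 ≠ []) (h : ¬ IsNormal S (u.1 ++ v.1)) :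
    b u * b v ∈ Submodule.span k (b '' {w | w.1 ≠ [] ∧ IsLower (u.1 ++ v.1) w.1}) := by
  refine Submodule.span_mono (Set.image_mono ?_) (hb.mul_of_not_isNormal u v h)
  refine fun w hw => ⟨fun h0 => hu ?_, hw⟩
  have := hw.1
  simp only [h0, List.length_nil, List.length_append] at this
  exact List.length_eq_zero_iff.1 (by omega)

lemma mul_mem_isLowerOrEq (hb : IsPBWBasis b) {u v : NormalWord S} (hu : u.1 ≠ []) :
    b u * b v ∈ Submodule.span k (b '' {w | w.1 ≠ [] ∧ IsLowerOrEq (u.1 ++ v.1) w.1}) := by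
  by_cases h : IsNormal S (u.1 ++ v.1)
  · rw [hb.mul_of_isNormal u v h]
    exact Submodule.subset_span ⟨_, ⟨by simp [hu], .inl rfl⟩, rfl⟩
  · refine Submodule.span_mono (Set.image_mono ?_) (hb.mul_mem_isLower hu h)
    exact fun w hw => ⟨hw.1, .inr hw.2⟩

lemma mulHead_mem_isLowerOrEq (hb : IsPBWBasis b)
    {u : NormalWord S} (hu : u.1 ≠ []) {l : List (NormalWord S)}
    (hl : ∀ v ∈ l, v.1 ≠ []) :
    mulHead b (b u) (wordBasis b l) ∈ barSpan b l.length (IsLowerOrEq (u.1 ++ cat l)) := by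
  cases l with
  | nil => simp
  | cons v l =>
    rw [wordBasis_cons, mulHead_ι_mul]
    refine ι_mul_mem_barSpan (hb.mul_mem_isLowerOrEq hu)
      (wordBasis_mem_barSpan (Q := (· = cat l)) rfl (fun x hx => hl x (by simp [hx])) rfl) ?_
    rintro w _ (rfl | hw) rfl
    · exact .inl (by simp)
    · exact .inr (by simpa using hw.append_right (cat l))

/-- The factor after `x` begins with `y` and `S x y` holds, so removing this bar never gives a
normal word and only smaller terms remain. -/
lemma mulHead_mem_isLower (hb : IsPBWBasis b)
    {x y : X} (hxy : S x y) {w : List X} {t : TensorAlgebra k B}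
    (ht : t ∈ barSpan b n (· = y :: w)) :
    mulHead b (b (letter S x)) t ∈ barSpan b n (IsLower (x :: y :: w)) := by
  refine barSpan_le_comap (fun l h1 h2 h3 => ?_) ht
  subst h1
  cases l with
  | nil => simp
  | cons v l =>
    rw [wordBasis_cons, mulHead_ι_mul]
    have hn : ¬ IsNormal S ((letter S x).1 ++ v.1) := by
      obtain ⟨z, v', hv⟩ := List.exists_cons_of_ne_nil (h2 v (by simp))
      rw [cat_cons, hv] at h3
      obtain rfl : z = y := by simpa using (List.cons.inj h3).1
      simp [letter, hv, isNormal_cons_cons, hxy]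
    refine ι_mul_mem_barSpan (hb.mul_mem_isLower (by simp [letter]) hn)
      (wordBasis_mem_barSpan (Q := (· = cat l)) rfl (fun x hx => h2 x (by simp [hx])) rfl) ?_
    rintro w' _ hw rfl
    rw [← h3]
    simpa [letter] using hw.append_right (cat l)

/-- Each face multiplies two neighbours, which either preserves the concatenation or lowers it
inside its context; the order is compatible with concatenation on both sides. -/
lemma tensorBarD_mem_barSpan (hb : IsPBWBasis b) {l : List (NormalWord S)} (hn : l.length = n + 1)
    (hl : ∀ v ∈ l, v.1 ≠ []) :
    tensorBarD b (wordBasis b l) ∈ barSpan b n (IsLowerOrEq (cat l)) := by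
  induction l generalizing n with
  | nil => simp at hn
  | cons u l ih =>
    have hu : u.1 ≠ [] := hl u (by simp)
    have hl' : ∀ v ∈ l, v.1 ≠ [] := fun x hx => hl x (by simp [hx])
    obtain rfl : l.length = n := by simpa using hn
    rw [wordBasis_cons, tensorBarD_ι_mul]
    refine Submodule.sub_mem _ (hb.mulHead_mem_isLowerOrEq hu hl') ?_
    cases h : l with
    | nil => simp
    | cons v l' =>
      rw [← h]
      have := ih (n := l'.length) (by simp [h]) hl'
      rw [h] at this ⊢
      refine ι_basis_mul_mem_barSpan hu this ?_
      rintro w (rfl | hw)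
      · exact .inl rfl
      · exact .inr (hw.append_left u.1)

end IsPBWBasis

end PBWBasis

/-! ### Acyclicity of the bar complex off the diagonal -/

section Acyclic

open TensorAlgebra (ι)

variable {X : Type*} {S : X → X → Prop} [LinearOrder X] {k B : Type*} [Field k] [Ring B]
  [Algebra k B] {b : Module.Basis (NormalWord S) k B} {n : ℕ}

namespace IsPBWBasis

/-- With first factor `x y w` and remaining tensor `t`, the terms containing `d t` cancel and the
original tensor appears when the split-off letter is multiplied back. What remains is `h (xyw · t) -
x ⊗ (yw · t)`. -/
lemma homotopy_formula_of_long (hb : IsPBWBasis b)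
    {x y : X} {w : List X} (hw : IsNormal S (x :: y :: w))
    {l : List (NormalWord S)} (hl : ∀ v ∈ l, v.1 ≠ []) :
    tensorBarD b (homotopy b (wordBasis b (⟨x :: y :: w, hw⟩ :: l))) +
      homotopy b (tensorBarD b (wordBasis b (⟨x :: y :: w, hw⟩ :: l))) -
        wordBasis b (⟨x :: y :: w, hw⟩ :: l) ∈
      barSpan b (l.length + 1) (IsLower (x :: y :: w ++ cat l)) := by
  have hw' : IsNormal S (y :: w) := (isNormal_cons_cons.1 hw).2
  have hx : b (letter S x) * b ⟨y :: w, hw'⟩ = b ⟨x :: y :: w, hw⟩ :=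
    hb.mul_of_isNormal (letter S x) ⟨y :: w, hw'⟩ hw
  have key : tensorBarD b (homotopy b (wordBasis b (⟨x :: y :: w, hw⟩ :: l))) +
      homotopy b (tensorBarD b (wordBasis b (⟨x :: y :: w, hw⟩ :: l))) -
        wordBasis b (⟨x :: y :: w, hw⟩ :: l) =
      homotopy b (mulHead b (b ⟨x :: y :: w, hw⟩) (wordBasis b l)) -
        ι k (b (letter S x)) * mulHead b (b ⟨y :: w, hw'⟩) (wordBasis b l) := by
    simp only [wordBasis_cons, homotopy_ι_mul, tensorBarD_ι_mul, mulHead_ι_mul, hx, map_sub,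
      mul_sub]
    abel
  rw [key]
  cases l with
  | nil => simp
  | cons v l =>
    have hl' : wordBasis b l ∈ barSpan b l.length (· = cat l) :=
      wordBasis_mem_barSpan rfl (fun x hx => hl x (by simp [hx])) rfl
    rw [wordBasis_cons, mulHead_ι_mul, mulHead_ι_mul]
    -- If the next bar can be removed, `h` splits `x` off the product again and both terms agree;
    -- otherwise both are already lower. The two products are normal simultaneously, since prefixing
    -- `x` only adds the pair `x, y`.
    by_cases hn : IsNormal S (y :: w ++ v.1)
    · have hn' : IsNormal S (x :: y :: w ++ v.1) :=
        isNormal_cons_cons.2 ⟨(isNormal_cons_cons.1 hw).1, hn⟩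
      rw [hb.mul_of_isNormal ⟨y :: w, hw'⟩ v hn, hb.mul_of_isNormal ⟨x :: y :: w, hw⟩ v hn']
      have := homotopy_ι_mul (b := b) (w := w ++ v.1) hn' (wordBasis b l)
      simp only [List.cons_append] at this ⊢
      rw [this, sub_self]
      exact zero_mem _
    · have hn' : ¬ IsNormal S (x :: y :: w ++ v.1) := fun h => hn (isNormal_cons_cons.1 h).2
      refine Submodule.sub_mem _ (homotopy_mem_barSpan (n := l.length + 1) ?_)
        (ι_basis_mul_mem_barSpan (n := l.length + 1) (Q := IsLower (y :: w ++ v.1 ++ cat l))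
          (by simp [letter]) ?_ ?_)
      · refine ι_mul_mem_barSpan (hb.mul_mem_isLower (by simp) hn') hl' ?_
        rintro u _ hu rfl
        simpa using hu.append_right (cat l)
      · refine ι_mul_mem_barSpan (hb.mul_mem_isLower (by simp) hn) hl' ?_
        rintro u _ hu rfl
        simpa using hu.append_right (cat l)
      · intro u hu
        simpa [letter] using hu.append_left [x]

/-- The length hypothesis says that some factor has at least two letters; leading single letters are
peeled off by induction. On tuples of single letters the formula fails, and this is the diagonal. -/
lemma homotopy_formula (hb : IsPBWBasis b) {l : List (NormalWord S)} (hl : ∀ v ∈ l, v.1 ≠ [])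
    (hlen : l.length < (cat l).length) :
    tensorBarD b (homotopy b (wordBasis b l)) + homotopy b (tensorBarD b (wordBasis b l)) -
      wordBasis b l ∈ barSpan b l.length (IsLower (cat l)) := by
  induction l with
  | nil => simp at hlen
  | cons u l ih =>
    have hl' : ∀ v ∈ l, v.1 ≠ [] := fun x hx => hl x (by simp [hx])
    rcases u with ⟨_ | ⟨x, _ | ⟨y, w⟩⟩, h⟩
    · exact absurd rfl (hl _ (List.mem_cons_self ..))
    · change tensorBarD b (homotopy b (wordBasis b (letter S x :: l))) +
        homotopy b (tensorBarD b (wordBasis b (letter S x :: l))) -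
          wordBasis b (letter S x :: l) ∈ barSpan b (l.length + 1) (IsLower (x :: cat l))
      simp only [cat_cons, List.length_cons, List.cons_append, List.nil_append] at hlen
      obtain ⟨v, l', rfl⟩ : ∃ v l', l = v :: l' := by
        cases l with
        | nil => simp at hlen
        | cons v l' => exact ⟨v, l', rfl⟩
      obtain ⟨y, v', hv⟩ := List.exists_cons_of_ne_nil (hl' v (by simp))
      have hcat : cat (v :: l') = y :: (v' ++ cat l') := by simp [hv]
      have hmem : wordBasis b (v :: l') ∈ barSpan b (l'.length + 1) (· = y :: (v' ++ cat l')) :=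
        wordBasis_mem_barSpan rfl hl' hcat
      -- The differential of the tail splits into a part `p` with unchanged concatenation, on which
      -- `h (x ⊗ p)` is known, and a lower part `q`, about which only the filtration level matters.
      obtain ⟨p, hp, q, hq, hpq⟩ := exists_add_of_mem_barSpan_isLowerOrEq
        (hb.tensorBarD_mem_barSpan (n := l'.length) (l := v :: l') rfl hl')
      have hxq : ι k (b (letter S x)) * q ∈
          barSpan b (l'.length + 1) (IsLower (x :: cat (v :: l'))) :=
        ι_basis_mul_mem_barSpan (by simp [letter]) hq fun u hu => by
          simpa [letter] using hu.append_left [x]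
      rw [hcat] at hp
      -- If `S x y`, the bar after `x` contributes only lower terms and the formula for the tail is
      -- inherited. If not, `h` kills `x ⊗ t`, but `d` joins `x` to the next factor and `h` splits
      -- it off again, which restores the original tensor.
      by_cases hxy : S x y
      · have key : tensorBarD b (homotopy b (wordBasis b (letter S x :: v :: l'))) +
            homotopy b (tensorBarD b (wordBasis b (letter S x :: v :: l'))) -
              wordBasis b (letter S x :: v :: l') =
            ι k (b (letter S x)) * (tensorBarD b (homotopy b (wordBasis b (v :: l'))) +
              homotopy b (tensorBarD b (wordBasis b (v :: l'))) - wordBasis b (v :: l')) -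
            mulHead b (b (letter S x)) (homotopy b (wordBasis b (v :: l'))) +
            homotopy b (mulHead b (b (letter S x)) (wordBasis b (v :: l'))) -
            ι k (b (letter S x)) * homotopy b q - homotopy b (ι k (b (letter S x)) * q) := by
          rw [wordBasis_cons b (letter S x), homotopy_letter_of_rel hxy hmem, map_neg,
            tensorBarD_ι_mul, tensorBarD_ι_mul, ← hpq, map_sub, mul_add, map_add,
            homotopy_letter_of_rel hxy hp, map_add]
          noncomm_ring
        rw [key]
        have hQ : ∀ u, IsLower (cat (v :: l')) u →
            IsLower (x :: cat (v :: l')) ((letter S x).1 ++ u) := fun u hu => by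
          simpa [letter] using hu.append_left [x]
        refine Submodule.sub_mem _ (Submodule.sub_mem _ (Submodule.add_mem _
          (Submodule.sub_mem _ ?_ ?_) ?_) ?_) (homotopy_mem_barSpan hxq)
        · exact ι_basis_mul_mem_barSpan (by simp [letter])
            (ih hl' (by simp only [List.length_cons] at hlen ⊢; omega)) hQ
        · rw [hcat]
          exact hb.mulHead_mem_isLower hxy (homotopy_mem_barSpan hmem)
        · rw [hcat]
          exact homotopy_mem_barSpan (hb.mulHead_mem_isLower hxy hmem)
        · exact ι_basis_mul_mem_barSpan (by simp [letter]) (homotopy_mem_barSpan hq) hQ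
      · have hn : IsNormal S (x :: y :: v') :=
          isNormal_cons_cons.2 ⟨hxy, hv ▸ v.2⟩
        have hv' : ⟨y :: v', (isNormal_cons_cons.1 hn).2⟩ = v := Subtype.ext hv.symm
        have hx : b (letter S x) * b v = b ⟨x :: y :: v', hn⟩ := by
          rw [← hv']
          exact hb.mul_of_isNormal (letter S x) ⟨y :: v', _⟩ hn
        have key : tensorBarD b (homotopy b (wordBasis b (letter S x :: v :: l'))) +
            homotopy b (tensorBarD b (wordBasis b (letter S x :: v :: l'))) -
              wordBasis b (letter S x :: v :: l') =
            - homotopy b (ι k (b (letter S x)) * q) := by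
          rw [wordBasis_cons b (letter S x), homotopy_letter_of_not_rel hxy hmem,
            tensorBarD_ι_mul, ← hpq, map_sub, mul_add, map_add,
            homotopy_letter_of_not_rel hxy hp, wordBasis_cons, mulHead_ι_mul, hx, homotopy_ι_mul,
            hv']
          simp
        rw [key]
        exact Submodule.neg_mem _ (homotopy_mem_barSpan hxq)
    · exact hb.homotopy_formula_of_long h hl'

/-- The cycles of the bar complex outside of the diagonal are boundaries. -/
lemma exists_tensorBarD_eq (hb : IsPBWBasis b)
    [Finite X] {j : ℕ} (hj : n + 1 < j) {t : TensorAlgebra k B}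
    (ht : t ∈ barSpan b (n + 1) fun w => w.length = j) (hd : tensorBarD b t = 0) :
    ∃ s ∈ barSpan b (n + 2) fun w => w.length = j, tensorBarD b s = t := by
  -- Induction on a bound for the rank of the concatenated words, available since there are finitely
  -- many words of length `j`.
  suffices H : ∀ (r : ℕ) (t : TensorAlgebra k B),
      t ∈ barSpan b (n + 1) (fun w => w.length = j ∧ wordRank w < r) → tensorBarD b t = 0 →
      ∃ s ∈ barSpan b (n + 2) fun w => w.length = j, tensorBarD b s = t by
    obtain ⟨r, hr⟩ : ∃ r, ∀ w : List X, w.length = j → wordRank w < r := by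
      obtain ⟨r, hr⟩ := ((List.finite_length_eq X j).image wordRank).bddAbove
      exact ⟨r + 1, fun w hw => Nat.lt_succ_of_le (hr ⟨w, hw, rfl⟩)⟩
    exact H r t (barSpan_mono (fun w hw => ⟨hw, hr w hw⟩) ht) hd
  intro r
  induction r with
  | zero =>
    intro t ht _
    have : t = 0 := by
      simpa [barSpan] using ht
    exact ⟨0, zero_mem _, by simp [this]⟩
  | succ r ih =>
    intro t ht hd
    have hN : tensorBarD b (homotopy b t) + homotopy b (tensorBarD b t) - t ∈
        barSpan b (n + 1) (fun w => w.length = j ∧ wordRank w < r) := by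
      refine barSpan_le_comap (f := tensorBarD b ∘ₗ homotopy b + homotopy b ∘ₗ tensorBarD b -
        LinearMap.id) (fun l h1 h2 h3 => ?_) ht
      rw [← h1]
      refine barSpan_mono (fun w hw => ?_) (hb.homotopy_formula h2 (by omega))
      exact ⟨hw.1.trans h3.1, by have := hw.wordRank_lt; omega⟩
    rw [hd, map_zero, add_zero] at hN
    obtain ⟨s, hs, hs'⟩ := ih _ hN (by rw [map_sub, tensorBarD_tensorBarD, hd, sub_zero])
    -- For a cycle, the error `d (h t) - t` is again a cycle, of lower rank, hence equal to `d s`;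
    -- so `t = d (h t - s)`.
    refine ⟨homotopy b t - s, Submodule.sub_mem _ (homotopy_mem_barSpan
      (barSpan_mono (fun w hw => hw.1) ht)) hs, ?_⟩
    rw [map_sub, hs', sub_sub_cancel]

end IsPBWBasis

end Acyclic

/-! ### Algebras with a PBW basis are Koszul -/

section Koszul

open TensorAlgebra (ι)

variable {X : Type*} {S : X → X → Prop} {k B : Type*} [Field k] [Ring B]
  [Algebra k B] (b : Module.Basis (NormalWord S) k B)

/-- The grading by length of words. -/
def lengthGrading (n : ℕ) : Submodule k B := Submodule.span k (b '' {w | w.1.length = n})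

variable {b}

lemma basis_mem_lengthGrading (w : NormalWord S) : b w ∈ lengthGrading b w.1.length :=
  Submodule.subset_span ⟨w, rfl, rfl⟩

lemma tprod_mem_barSpan {n : ℕ} {d : Fin n → ℕ} {a : Fin n → B} (hd : ∀ i, 0 < d i)
    (ha : ∀ i, a i ∈ lengthGrading b (d i)) :
    TensorAlgebra.tprod k B n a ∈ barSpan b n fun w => w.length = ∑ i, d i := by
  induction n with
  | zero =>
    have : TensorAlgebra.tprod k B 0 a = wordBasis b [] := by simp [TensorAlgebra.tprod_apply]
    rw [this]
    exact wordBasis_mem_barSpan rfl (by simp) (by simp)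
  | succ n ih =>
    rw [tprod_succ, Fin.sum_univ_succ]
    refine ι_mul_mem_barSpan (P := fun w => w.length = d 0) ?_
      (ih (d := Fin.tail d) (a := Fin.tail a) (fun i => hd _) fun i => ha _) ?_
    · refine Submodule.span_mono (Set.image_mono ?_) (ha 0)
      intro w (hw : w.1.length = d 0)
      exact ⟨fun h => by have := hd 0; simp [h] at hw; omega, hw⟩
    · intro u w hu hw
      simp [hu, hw, Fin.tail]

lemma toTensorAlgebra_mem_barSpan {n j : ℕ} {x : ⨂[k] _ : Fin n, B}
    (hx : x ∈ bar (lengthGrading b) n j) :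
    TensorPower.toTensorAlgebra x ∈ barSpan b n fun w => w.length = j := by
  have : bar (lengthGrading b) n j ≤ (barSpan b n fun w => w.length = j).comap
      (TensorPower.toTensorAlgebra : (⨂[k] _ : Fin n, B) →ₗ[k] _) := by
    refine Submodule.span_le.2 ?_
    rintro _ ⟨d, a, hd, rfl, ha, rfl⟩
    rw [SetLike.mem_coe, Submodule.mem_comap, TensorPower.toTensorAlgebra_tprod]
    exact tprod_mem_barSpan hd ha
  exact this hx

lemma exists_toTensorAlgebra_eq {n j : ℕ} {t : TensorAlgebra k B}
    (ht : t ∈ barSpan b n fun w => w.length = j) :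
    ∃ x ∈ bar (lengthGrading b) n j, TensorPower.toTensorAlgebra x = t := by
  have : (barSpan b n fun w => w.length = j) ≤ (bar (lengthGrading b) n j).map
      (TensorPower.toTensorAlgebra : (⨂[k] _ : Fin n, B) →ₗ[k] _) := by
    refine Submodule.span_le.2 ?_
    rintro _ ⟨l, ⟨rfl, h2, rfl⟩, rfl⟩
    refine ⟨PiTensorProduct.tprod k fun i => b (l.get i), Submodule.subset_span
      ⟨fun i => (l.get i).1.length, _, fun i => List.length_pos_iff.2 (h2 _ (l.get_mem i)), ?_,
        fun i => basis_mem_lengthGrading _, rfl⟩, ?_⟩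
    · rw [← List.sum_ofFn, cat, List.length_flatten, List.map_map]
      congr 1
      exact (List.ofFn_comp' l.get fun u : NormalWord S => u.1.length).trans
        (by rw [List.ofFn_get]; rfl)
    · refine (TensorPower.toTensorAlgebra_tprod _).trans ?_
      rw [TensorAlgebra.tprod_apply, wordBasis_eq_prod]
      congr 1
      exact (List.ofFn_comp' l.get fun u : NormalWord S => ι k (b u)).trans
        (by rw [List.ofFn_get])
  exact this ht

lemma bar_eq_bot {𝓑 : ℕ → Submodule k B} {n j : ℕ} (h : j < n) : bar 𝓑 n j = ⊥ := by
  refine (Submodule.span_eq_bot).2 ?_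
  rintro _ ⟨d, a, hd, rfl, -⟩
  have : ∑ _i : Fin n, 1 ≤ ∑ i, d i := Finset.sum_le_sum fun i _ => hd i
  simp at this
  omega

lemma bar_zero_eq_bot {𝓑 : ℕ → Submodule k B} {j : ℕ} (h : j ≠ 0) : bar 𝓑 0 j = ⊥ := by
  refine (Submodule.span_eq_bot).2 ?_
  rintro _ ⟨d, a, hd, rfl, -⟩
  simp at h

lemma lengthGrading_map {B' : Type*} [Ring B'] [Algebra k B'] (e : B ≃ₐ[k] B') (n : ℕ) :
    lengthGrading (b.map e.toLinearEquiv) n = (lengthGrading b n).map e.toLinearMap := by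
  rw [lengthGrading, lengthGrading, Submodule.map_span, Set.image_image]
  rfl

variable [LinearOrder X]

namespace IsPBWBasis

/-- Below the diagonal the reduced bar complex is zero, as `n` positive degrees sum to at least `n`.
Above it, the contraction in `T(B)` applies. -/
lemma barCycles_le_barBoundaries (hb : IsPBWBasis b) [Finite X] {n j : ℕ} (h : j ≠ n) :
    barCycles (lengthGrading b) n j ≤ barBoundaries (lengthGrading b) n j := by
  cases n with
  | zero => simp [barCycles, bar_zero_eq_bot h]
  | succ n =>
    rcases lt_or_gt_of_ne h with h | h
    · simp [barCycles, bar_eq_bot h]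
    · rintro x ⟨hx, hx'⟩
      have hx'' : barD k B n x = 0 := hx'
      have hd := toTensorAlgebra_barD b n x
      rw [hx'', map_zero] at hd
      obtain ⟨s, hs, hs'⟩ := hb.exists_tensorBarD_eq h (toTensorAlgebra_mem_barSpan hx) hd.symm
      obtain ⟨y, hy, rfl⟩ := exists_toTensorAlgebra_eq hs
      refine ⟨y, hy, toTensorAlgebra_injective (n + 1) ?_⟩
      rw [toTensorAlgebra_barD b, hs']

lemma basis_mul_mem (hb : IsPBWBasis b) (u v : NormalWord S) :
    b u * b v ∈ lengthGrading b (u.1.length + v.1.length) := by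
  by_cases h : IsNormal S (u.1 ++ v.1)
  · rw [hb.mul_of_isNormal u v h]
    exact Submodule.subset_span ⟨_, by simp, rfl⟩
  · refine Submodule.span_mono (Set.image_mono ?_) (hb.mul_of_not_isNormal u v h)
    intro w hw
    simpa using hw.1

lemma basis_mem_adjoin (hb : IsPBWBasis b) (w : NormalWord S) :
    b w ∈ Algebra.adjoin k (lengthGrading b 1 : Set B) := by
  obtain ⟨w, hw⟩ := w
  induction w with
  | nil => exact hb.one ▸ one_mem _
  | cons x w ih =>
    have hw' : IsNormal S w := List.IsChain.tail hw
    have h : b (letter S x) * b ⟨w, hw'⟩ = b ⟨x :: w, hw⟩ :=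
      hb.mul_of_isNormal (letter S x) ⟨w, hw'⟩ hw
    rw [← h]
    exact mul_mem (Algebra.subset_adjoin (basis_mem_lengthGrading (letter S x))) (ih hw')

lemma isStandard (hb : IsPBWBasis b) [Finite X] : IsStandard (lengthGrading b) where
  one_mem := hb.one ▸ basis_mem_lengthGrading (emptyWord S)
  mul_mem i j x y hx hy := by
    have : Submodule.map₂ (LinearMap.mul k B) (lengthGrading b i) (lengthGrading b j) ≤
        lengthGrading b (i + j) := by
      rw [lengthGrading, lengthGrading, Submodule.map₂_span_span, Submodule.span_le]
      rintro _ ⟨_, ⟨u, rfl, rfl⟩, _, ⟨v, rfl, rfl⟩, rfl⟩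
      exact hb.basis_mul_mem u v
    exact this (Submodule.apply_mem_map₂ _ hx hy)
  isInternal := by
    rw [DirectSum.isInternal_submodule_iff_iSupIndep_and_iSup_eq_top]
    constructor
    · intro i
      change Disjoint (Submodule.span k _) _
      refine Disjoint.mono_right (c := Submodule.span k (b '' {w | w.1.length ≠ i})) ?_
        (b.linearIndependent.disjoint_span_image ?_)
      · refine iSup₂_le fun j hj => Submodule.span_mono (Set.image_mono ?_)
        rintro w (rfl : w.1.length = j)
        exact hj
      · exact Set.disjoint_left.2 fun w h h' => h' h
    · rw [eq_top_iff, ← b.span_eq, Submodule.span_le]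
      rintro _ ⟨w, rfl⟩
      exact Submodule.mem_iSup_of_mem w.1.length (basis_mem_lengthGrading w)
  finite i := by
    have : {w : NormalWord S | w.1.length = i}.Finite :=
      (List.finite_length_eq X i).preimage Subtype.val_injective.injOn
    exact FiniteDimensional.span_of_finite k (this.image b)
  nontrivial := ⟨b (emptyWord S), 0, b.ne_zero _⟩
  connected := by
    rw [lengthGrading, ← hb.one, ← Set.image_singleton]
    congr 2
    ext w
    simp [emptyWord, Subtype.ext_iff]
  generated := by
    rw [eq_top_iff]
    intro x _
    have : Submodule.span k (Set.range b) ≤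
        Subalgebra.toSubmodule (Algebra.adjoin k (lengthGrading b 1 : Set B)) := by
      rw [Submodule.span_le]
      rintro _ ⟨w, rfl⟩
      exact hb.basis_mem_adjoin w
    exact this (b.span_eq ▸ Submodule.mem_top)

/-- An algebra with a PBW basis is Koszul. -/
theorem isKoszul (hb : IsPBWBasis b) [Finite X] : IsKoszul (lengthGrading b) where
  toIsStandard := hb.isStandard
  tor_concentrated n j h := by
    rw [Submodule.Quotient.subsingleton_iff, Submodule.submoduleOf_eq_top]
    exact hb.barCycles_le_barBoundaries h

/-- A PBW basis is carried to a PBW basis by an isomorphism of algebras. -/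
lemma map (hb : IsPBWBasis b) {B' : Type*} [Ring B'] [Algebra k B'] (e : B ≃ₐ[k] B') :
    IsPBWBasis (b.map e.toLinearEquiv) where
  one := by simp [hb.one]
  mul_of_isNormal u v h := by simp [← hb.mul_of_isNormal u v h]
  mul_of_not_isNormal u v h := by
    have := Submodule.mem_map_of_mem (f := e.toLinearMap) (hb.mul_of_not_isNormal u v h)
    rw [Submodule.map_span, Set.image_image] at this
    simp only [Module.Basis.map_apply, AlgEquiv.toLinearEquiv_apply, ← map_mul]
    exact this

end IsPBWBasis

end Koszul

/-! ### Spans of words in the tensor algebra -/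

section WordSpan

open TensorAlgebra (ι)

variable {X k V : Type*} [Field k] [AddCommGroup V] [Module k V] (c : Module.Basis X k V)

/-- The span of the words in the basis `c` which satisfy `Q`. -/
def wordSpan (Q : List X → Prop) : Submodule k (TensorAlgebra k V) :=
  Submodule.span k (wordBasis c '' {w | Q w})

variable {c} {P Q Q' : List X → Prop}

lemma wordBasis_mem_wordSpan {w : List X} (h : Q w) : wordBasis c w ∈ wordSpan c Q :=
  Submodule.subset_span ⟨w, h, rfl⟩

lemma wordSpan_mono (h : ∀ w, Q w → Q' w) : wordSpan c Q ≤ wordSpan c Q' :=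
  Submodule.span_mono (Set.image_mono h)

lemma mem_wordSpan_iff {f : TensorAlgebra k V} :
    f ∈ wordSpan c Q ↔ ∀ w, (wordBasis c).repr f w ≠ 0 → Q w := by
  rw [wordSpan, Module.Basis.mem_span_image]
  simp [Set.subset_def]

lemma repr_eq_zero_of_mem_wordSpan {f : TensorAlgebra k V} (hf : f ∈ wordSpan c Q) {w : List X}
    (hw : ¬ Q w) : (wordBasis c).repr f w = 0 := by
  by_contra h
  exact hw (mem_wordSpan_iff.1 hf w h)

lemma mul_mem_wordSpan {f g : TensorAlgebra k V} (hf : f ∈ wordSpan c P) (hg : g ∈ wordSpan c Q)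
    (h : ∀ u w, P u → Q w → Q' (u ++ w)) : f * g ∈ wordSpan c Q' := by
  have : wordSpan c P * wordSpan c Q ≤ wordSpan c Q' := by
    rw [wordSpan, wordSpan, Submodule.span_mul_span, Submodule.span_le]
    rintro _ ⟨_, ⟨u, hu, rfl⟩, _, ⟨w, hw, rfl⟩, rfl⟩
    simp only [← wordBasis_append]
    exact wordBasis_mem_wordSpan (h u w hu hw)
  exact this (Submodule.mul_mem_mul hf hg)

lemma exists_add_of_mem_wordSpan (P : List X → Prop) {f : TensorAlgebra k V}
    (hf : f ∈ wordSpan c Q) :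
    ∃ p ∈ wordSpan c (fun w => Q w ∧ P w), ∃ q ∈ wordSpan c (fun w => Q w ∧ ¬ P w), p + q = f := by
  refine Submodule.mem_sup.1 ((?_ : wordSpan c Q ≤ _) hf)
  refine Submodule.span_le.2 ?_
  rintro _ ⟨w, hw, rfl⟩
  by_cases h : P w
  · exact Submodule.mem_sup_left (wordBasis_mem_wordSpan ⟨hw, h⟩)
  · exact Submodule.mem_sup_right (wordBasis_mem_wordSpan ⟨hw, h⟩)

lemma wordSpan_true : wordSpan c (fun _ => True) = ⊤ := by
  rw [wordSpan, ← (wordBasis c).span_eq, Set.ofPred_true, Set.image_univ]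

variable (c) in
lemma tensorGrading_eq_wordSpan (m : ℕ) :
    tensorGrading k V m = wordSpan c fun w => w.length = m := by
  induction m with
  | zero =>
    have : {w : List X | w.length = 0} = {[]} := by ext; simp
    rw [wordSpan, this, Set.image_singleton, wordBasis_nil, tensorGrading, pow_zero,
      Submodule.one_eq_span]
  | succ m ih =>
    have h1 : LinearMap.range (ι k : V →ₗ[k] TensorAlgebra k V) =
        Submodule.span k (Set.range fun x => ι k (c x)) := by
      rw [LinearMap.range_eq_map, ← c.span_eq, Submodule.map_span, ← Set.range_comp]; rfl
    rw [tensorGrading, pow_succ', ← tensorGrading, ih, h1, wordSpan, wordSpan,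
      Submodule.span_mul_span]
    congr 1
    ext f
    constructor
    · rintro ⟨_, ⟨x, rfl⟩, _, ⟨w, hw, rfl⟩, rfl⟩
      exact ⟨x :: w, congrArg (· + 1) hw, wordBasis_cons c x w⟩
    · rintro ⟨_ | ⟨x, w⟩, hw, rfl⟩
      · simp at hw
      · exact ⟨_, ⟨x, rfl⟩, _, ⟨w, by simpa using hw, rfl⟩, (wordBasis_cons c x w).symm⟩

end WordSpan

/-! ### The reduction of words modulo the quadratic relations -/

section Reduction

variable {k V : Type*} [Field k] [AddCommGroup V] [Module k V] {n : ℕ}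
  {c : Module.Basis (Fin n) k V} {R : Submodule k (TensorAlgebra k V)}

lemma isLeadingWord_iff {f : TensorAlgebra k V} {w : FreeMonoid (Fin n)} :
    IsLeadingWord c f w ↔ (wordBasis c).repr f w.toList ≠ 0 ∧
      ∀ u, (wordBasis c).repr f u ≠ 0 → u ≠ w.toList → WordLT u w.toList := by
  simp only [wordBasis, Module.Basis.repr_reindex_apply]
  rfl

variable (c R) in
/-- The pairs of letters which are leading words of relations. -/
def LeadingPair (x y : Fin n) : Prop := ∃ f ∈ R, IsLeadingWord c f (FreeMonoid.ofList [x, y])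

lemma exists_isLeadingWord {f : TensorAlgebra k V} (hf : f ≠ 0) :
    ∃ w : FreeMonoid (Fin n), IsLeadingWord c f w := by
  obtain ⟨w, hw, h⟩ := exists_greatest_word ((wordBasis c).repr f).support (by simpa using hf)
  exact ⟨FreeMonoid.ofList w, isLeadingWord_iff.2
    ⟨by simpa using hw, fun u hu hne => h u (by simpa using hu) (by simpa using hne)⟩⟩

lemma exists_linear_add_quadratic (hR : R ≤ tensorGrading k V 1 ⊔ tensorGrading k V 2)
    {f : TensorAlgebra k V} (hf : f ∈ R) :
    ∃ p ∈ tensorGrading k V 1, ∃ q ∈ tensorGrading k V 2, p + q = f ∧ q ∈ quadraticPart R := by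
  obtain ⟨p, hp, q, hq, rfl⟩ := Submodule.mem_sup.1 (hR hf)
  refine ⟨p, hp, q, hq, rfl, p + q, hf, ?_⟩
  rw [map_add, GradedAlgebra.proj_apply, GradedAlgebra.proj_apply,
    DirectSum.decompose_of_mem_ne _ hp (by norm_num), DirectSum.decompose_of_mem_same _ hq,
    zero_add]

/-- A leading word of length one would force the whole relation into `V`, because longer words are
greater; then `R ∩ V = 0` would make it zero. -/
lemma exists_eq_pair_of_isLeadingWord (hR : R ≤ tensorGrading k V 1 ⊔ tensorGrading k V 2)
    (hR' : R ⊓ tensorGrading k V 1 = ⊥)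
    {f : TensorAlgebra k V} (hf : f ∈ R) {w : FreeMonoid (Fin n)} (hw : IsLeadingWord c f w) :
    ∃ x y, w.toList = [x, y] := by
  rw [isLeadingWord_iff] at hw
  have hlen : ∀ u, (wordBasis c).repr f u ≠ 0 → u.length = 1 ∨ u.length = 2 := by
    refine mem_wordSpan_iff.1 ((?_ : tensorGrading k V 1 ⊔ tensorGrading k V 2 ≤ _) (hR hf))
    rw [tensorGrading_eq_wordSpan c, tensorGrading_eq_wordSpan c]
    exact sup_le (wordSpan_mono fun _ => .inl) (wordSpan_mono fun _ => .inr)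
  rcases hlen _ hw.1 with h | h
  · have hf1 : f ∈ tensorGrading k V 1 := by
      rw [tensorGrading_eq_wordSpan c, mem_wordSpan_iff]
      intro u hu
      by_cases hne : u = w.toList
      · exact hne ▸ h
      · have := hw.2 u hu hne
        rw [WordLT, List.shortlex_def] at this
        have := hlen u hu
        omega
    have : f ∈ R ⊓ tensorGrading k V 1 := ⟨hf, hf1⟩
    rw [hR', Submodule.mem_bot] at this
    exact absurd (by simp [this]) hw.1
  · exact List.length_eq_two.1 h

lemma mk_pair_mem (hR : R ≤ tensorGrading k V 1 ⊔ tensorGrading k V 2)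
    {x y : Fin n} (hxy : LeadingPair c R x y) :
    ∃ g ∈ wordSpan c (IsLower [x, y]),
      (quadraticCon R).mkₐ k (wordBasis c [x, y]) = (quadraticCon R).mkₐ k g := by
  obtain ⟨f, hf, hlead⟩ := hxy
  rw [isLeadingWord_iff, FreeMonoid.toList_ofList] at hlead
  obtain ⟨p, hp, q, hq, rfl, hqR⟩ := exists_linear_add_quadratic hR hf
  rw [tensorGrading_eq_wordSpan c] at hp hq
  have hrepr : ∀ w : List (Fin n), w.length = 2 →
      (wordBasis c).repr (p + q) w = (wordBasis c).repr q w := fun w hw => by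
    rw [map_add, Finsupp.add_apply, repr_eq_zero_of_mem_wordSpan hp (by omega), zero_add]
  set a := (wordBasis c).repr q [x, y] with ha
  have ha0 : a ≠ 0 := by
    rw [ha, ← hrepr _ rfl]
    exact hlead.1
  have hq0 : (quadraticCon R).mkₐ k q = 0 := by
    refine (RingCon.eq (quadraticCon R)).2 ?_
    exact (TwoSidedIdeal.mem_iff _ _).1 (TwoSidedIdeal.subset_span hqR)
  -- The quadratic part `q` has the same coefficients as the relation on words of length two, so
  -- subtracting `a⁻¹ • q` cancels the leading word exactly.
  refine ⟨wordBasis c [x, y] - a⁻¹ • q, ?_, by rw [map_sub, map_smul, hq0, smul_zero, sub_zero]⟩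
  rw [mem_wordSpan_iff]
  intro w hw
  have hne : w ≠ [x, y] := by
    rintro rfl
    simp [← ha, ha0] at hw
  have hwq : (wordBasis c).repr q w ≠ 0 := by
    intro h
    simp [h, hne.symm] at hw
  have hlen : w.length = 2 := mem_wordSpan_iff.1 hq w hwq
  exact ⟨hlen, hlead.2 w (by rwa [hrepr w hlen]) hne⟩

/-- Modulo the quadratic relations, a word which is not normal is a combination of smaller
words. -/
lemma exists_mk_eq_of_not_isNormal (hR : R ≤ tensorGrading k V 1 ⊔ tensorGrading k V 2)
    {w : List (Fin n)} (hw : ¬ IsNormal (LeadingPair c R) w) :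
    ∃ g ∈ wordSpan c (IsLower w),
      (quadraticCon R).mkₐ k (wordBasis c w) = (quadraticCon R).mkₐ k g := by
  rw [IsNormal, List.isChain_iff_forall_rel_of_append_cons_cons] at hw
  push Not at hw
  obtain ⟨x, y, p, s, rfl, hxy⟩ := hw
  obtain ⟨g, hg, hg'⟩ := mk_pair_mem hR hxy
  refine ⟨wordBasis c p * (g * wordBasis c s), ?_, ?_⟩
  · refine mul_mem_wordSpan (P := (· = p)) (wordBasis_mem_wordSpan rfl)
      (mul_mem_wordSpan (Q := (· = s)) hg (wordBasis_mem_wordSpan rfl)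
        (Q' := IsLower ([x, y] ++ s)) ?_) ?_
    · rintro u _ hu rfl
      exact hu.append_right _
    · rintro _ u rfl hu
      exact hu.append_left _
  · rw [map_mul, map_mul, ← hg', ← map_mul, ← map_mul, ← wordBasis_append, ← wordBasis_append]
    rfl

lemma mk_mem_span_isLowerOrEq (hR : R ≤ tensorGrading k V 1 ⊔ tensorGrading k V 2)
    (w : List (Fin n)) :
    (quadraticCon R).mkₐ k (wordBasis c w) ∈ (wordSpan c fun u =>
      IsNormal (LeadingPair c R) u ∧ IsLowerOrEq w u).map ((quadraticCon R).mkₐ k).toLinearMap := by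
  induction w using isLower_induction with
  | ind w ih =>
    by_cases hw : IsNormal (LeadingPair c R) w
    · exact ⟨_, wordBasis_mem_wordSpan ⟨hw, .inl rfl⟩, rfl⟩
    · obtain ⟨g, hg, hg'⟩ := exists_mk_eq_of_not_isNormal hR hw
      rw [hg']
      refine Submodule.mem_comap.1 ((?_ : wordSpan c (IsLower w) ≤ Submodule.comap
        ((quadraticCon R).mkₐ k).toLinearMap _) hg)
      refine Submodule.span_le.2 ?_
      rintro _ ⟨u, hu, rfl⟩
      refine Submodule.map_mono (wordSpan_mono ?_) (ih u hu)
      rintro v ⟨hv, rfl | hv'⟩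
      exacts [⟨hv, .inr hu⟩, ⟨hv, .inr (hv'.trans hu)⟩]

lemma mk_mem_span_isLower (hR : R ≤ tensorGrading k V 1 ⊔ tensorGrading k V 2)
    {w : List (Fin n)} (hw : ¬ IsNormal (LeadingPair c R) w) :
    (quadraticCon R).mkₐ k (wordBasis c w) ∈ (wordSpan c fun u =>
      IsNormal (LeadingPair c R) u ∧ IsLower w u).map ((quadraticCon R).mkₐ k).toLinearMap := by
  refine Submodule.map_mono (wordSpan_mono ?_) (mk_mem_span_isLowerOrEq hR w)
  rintro v ⟨hv, rfl | hv'⟩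
  exacts [absurd hv hw, ⟨hv, hv'⟩]

lemma not_isNormal_of_isLeadingWord {G : Set (TensorAlgebra k V)}
    (hR : R ≤ tensorGrading k V 1 ⊔ tensorGrading k V 2) (hR' : R ⊓ tensorGrading k V 1 = ⊥)
    (hGR : G ⊆ R) {I : TwoSidedIdeal (TensorAlgebra k V)} (hG : IsGroebnerBasis c G I)
    {f : TensorAlgebra k V} (hf : f ∈ I) {w : FreeMonoid (Fin n)} (hw : IsLeadingWord c f w) :
    ¬ IsNormal (LeadingPair c R) w.toList := by
  obtain ⟨g, hg, u, hu, hinf⟩ := hG.2 f hf w hw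
  obtain ⟨x, y, hxy⟩ := exists_eq_pair_of_isLeadingWord hR hR' (hGR hg) hu
  intro h
  have h' := List.IsChain.infix h hinf
  rw [hxy, List.isChain_cons_cons] at h'
  exact h'.1 ⟨g, hGR hg, by rw [← hxy]; exact hu⟩

end Reduction

/-! ### The associated graded algebra -/

section AssociatedGraded

open TensorAlgebra (ι)

variable {k V A : Type*} [Field k] [AddCommGroup V] [Module k V] [Ring A] [Algebra k A]
  (π : TensorAlgebra k V →ₐ[k] A)

lemma map_ι_mem_filt (v : V) : π (ι k v) ∈ filt (generators π) 1 := by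
  rw [filt, pow_one]
  exact Submodule.mem_sup_right ⟨v, rfl⟩

/-- The homomorphism from the tensor algebra to the associated graded algebra which maps a
generator to its symbol. -/
def toGr : TensorAlgebra k V →ₐ[k] Gr (generators π) :=
  TensorAlgebra.lift k (DirectSum.lof k ℕ (GrComp (generators π)) 1 ∘ₗ symb (generators π) 1 ∘ₗ
    (π.toLinearMap ∘ₗ ι k).codRestrict (filt (generators π) 1) (map_ι_mem_filt π))

lemma toGr_ι (v : V) : toGr π (ι k v) = DirectSum.of (GrComp (generators π)) 1
    (symb (generators π) 1 ⟨π (ι k v), map_ι_mem_filt π v⟩) :=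
  TensorAlgebra.lift_ι_apply _ _

variable {X : Type*} (c : Module.Basis X k V)

/-- Products of symbols are symbols of products. The membership is bundled with the equation because
the symbol is only defined on the filtration step. -/
lemma exists_toGr_wordBasis (w : List X) : ∃ h : π (wordBasis c w) ∈ filt (generators π) w.length,
    toGr π (wordBasis c w) =
      DirectSum.of (GrComp (generators π)) w.length (symb (generators π) w.length ⟨_, h⟩) := by
  induction w with
  | nil =>
    refine ⟨by simpa using one_mem_filt, ?_⟩
    conv_lhs => rw [wordBasis_nil, map_one, DirectSum.one_def]
    refine DirectSum.of_eq_of_gradedMonoid_eq (mk_symb_eq rfl _ _ ?_)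
    simp
  | cons x w ih =>
    obtain ⟨h, h'⟩ := ih
    have hmem := mul_mem_filt (map_ι_mem_filt π (c x)) h
    rw [← map_mul, ← wordBasis_cons, add_comm] at hmem
    refine ⟨hmem, ?_⟩
    conv_lhs => rw [wordBasis_cons, map_mul, h', toGr_ι, DirectSum.of_mul_of]
    refine DirectSum.of_eq_of_gradedMonoid_eq (mk_symb_eq (add_comm 1 w.length) _ _ ?_)
    exact ((congrArg π (wordBasis_cons c x w)).trans (map_mul π _ _)).symm

lemma exists_toGr_eq {m : ℕ} {f : TensorAlgebra k V} (hf : f ∈ wordSpan c fun w => w.length = m) :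
    ∃ h : π f ∈ filt (generators π) m, toGr π f =
      DirectSum.of (GrComp (generators π)) m (symb (generators π) m ⟨_, h⟩) := by
  induction hf using Submodule.span_induction with
  | mem f hf =>
    obtain ⟨w, rfl, rfl⟩ := hf
    exact exists_toGr_wordBasis π c w
  | zero =>
    refine ⟨by simp, ?_⟩
    rw [map_zero, eq_comm, ← map_zero (DirectSum.of (GrComp (generators π)) m),
      ← map_zero (symb (generators π) m)]
    congr 2
    exact Subtype.ext (map_zero π)
  | add f g _ _ hf hg =>
    obtain ⟨h1, h1'⟩ := hf
    obtain ⟨h2, h2'⟩ := hg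
    refine ⟨by rw [map_add]; exact add_mem h1 h2, ?_⟩
    rw [map_add, h1', h2', ← map_add, ← map_add]
    congr 2
    exact Subtype.ext (map_add π f g).symm
  | smul a f _ hf =>
    obtain ⟨h1, h1'⟩ := hf
    refine ⟨by rw [map_smul]; exact Submodule.smul_mem _ _ h1, ?_⟩
    rw [map_smul, h1']
    refine (map_smul (DirectSum.lof k ℕ (GrComp (generators π)) m) a _).symm.trans
      (congrArg (DirectSum.of _ m) ?_)
    rw [← map_smul]
    congr 1
    exact Subtype.ext (map_smul π a f).symm

lemma filt_le_map_wordSpan (m : ℕ) :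
    filt (generators π) m ≤ (wordSpan c fun w => w.length ≤ m).map π.toLinearMap := by
  induction m with
  | zero =>
    rw [filt, pow_zero, Submodule.one_le]
    exact ⟨1, by rw [← wordBasis_nil c]; exact wordBasis_mem_wordSpan (by simp), map_one π⟩
  | succ m ih =>
    have h1 : (1 ⊔ generators π : Submodule k A) ≤
        (wordSpan c fun w => w.length ≤ 1).map π.toLinearMap := by
      refine sup_le (Submodule.one_le.2 ?_) ?_
      · exact ⟨1, by rw [← wordBasis_nil c]; exact wordBasis_mem_wordSpan (by simp), map_one π⟩
      · rintro _ ⟨v, rfl⟩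
        refine ⟨ι k v, ?_, rfl⟩
        refine wordSpan_mono (fun w hw => le_of_eq hw) (Q := fun w => w.length = 1) ?_
        rw [← tensorGrading_eq_wordSpan, tensorGrading, pow_one]
        exact ⟨v, rfl⟩
    rw [filt, pow_succ, Submodule.mul_le]
    intro x hx y hy
    obtain ⟨f, hf, rfl⟩ := ih hx
    obtain ⟨g, hg, rfl⟩ := h1 hy
    refine ⟨f * g, mul_mem_wordSpan hf hg ?_, map_mul π f g⟩
    intro u w hu hw
    rw [List.length_append]
    omega

lemma filtLT_eq_map_wordSpan (m : ℕ) :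
    filtLT (generators π) m = (wordSpan c fun w => w.length < m).map π.toLinearMap := by
  refine le_antisymm (iSup₂_le fun i hi => ?_) ?_
  · refine (filt_le_map_wordSpan π c i).trans (Submodule.map_mono (wordSpan_mono fun w hw => ?_))
    omega
  · rw [Submodule.map_le_iff_le_comap]
    refine Submodule.span_le.2 ?_
    rintro _ ⟨w, hw, rfl⟩
    exact filt_le_filtLT hw (exists_toGr_wordBasis π c w).1

/-- Lift to words of length at most `m`; those shorter than `m` do not affect the symbol and can be
dropped. -/
lemma exists_toGr_eq_of_symb {m : ℕ} (y : GrComp (generators π) m) :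
    ∃ f ∈ wordSpan c (fun w => w.length = m),
      toGr π f = DirectSum.of (GrComp (generators π)) m y := by
  obtain ⟨⟨x, hx⟩, rfl⟩ := symb_surjective m y
  obtain ⟨g, hg, rfl⟩ := filt_le_map_wordSpan π c m hx
  obtain ⟨p, hp, q, hq, rfl⟩ := exists_add_of_mem_wordSpan (fun w => w.length = m) hg
  have hp' : p ∈ wordSpan c fun w => w.length = m := wordSpan_mono (fun w hw => hw.2) hp
  obtain ⟨h, h'⟩ := exists_toGr_eq π c hp'
  refine ⟨p, hp', h'.trans (congrArg _ ?_)⟩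
  rw [eq_comm, ← sub_eq_zero, ← map_sub, symb_eq_zero_iff, filtLT_eq_map_wordSpan π c]
  refine ⟨q, wordSpan_mono (fun w hw => lt_of_le_of_ne hw.1 hw.2) hq, ?_⟩
  simp

lemma toGr_surjective : Function.Surjective (toGr π) := by
  intro y
  induction y using DirectSum.induction_on with
  | zero => exact ⟨0, map_zero _⟩
  | of m y =>
    obtain ⟨f, -, hf⟩ := exists_toGr_eq_of_symb π (Module.Basis.ofVectorSpace k V) y
    exact ⟨f, hf⟩
  | add y z hy hz =>
    obtain ⟨f, rfl⟩ := hy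
    obtain ⟨g, rfl⟩ := hz
    exact ⟨f + g, map_add _ f g⟩

lemma map_tensorGrading_toGr (m : ℕ) :
    (tensorGrading k V m).map (toGr π).toLinearMap = grGrading (generators π) m := by
  rw [tensorGrading_eq_wordSpan (Module.Basis.ofVectorSpace k V)]
  refine le_antisymm ?_ ?_
  · rintro _ ⟨f, hf, rfl⟩
    obtain ⟨h, h'⟩ := exists_toGr_eq π _ hf
    exact ⟨_, h'.symm⟩
  · rintro _ ⟨y, rfl⟩
    exact exists_toGr_eq_of_symb π _ y

variable {π c}

/-- If `p + q` is a relation with `p` linear and `q` quadratic, then `π q = -π p` lies in a lower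
filtration step, so `q` has zero symbol. -/
lemma toGr_eq_zero_of_mem_quadraticPart {R : Submodule k (TensorAlgebra k V)}
    (hA : IsAlmostQuadratic π R) {q : TensorAlgebra k V} (hq : q ∈ quadraticPart R) :
    toGr π q = 0 := by
  obtain ⟨f, hf, rfl⟩ := hq
  obtain ⟨p, hp, q, hq, rfl⟩ := Submodule.mem_sup.1 (hA.le hf)
  have hproj : GradedAlgebra.proj (tensorGrading k V) 2 (p + q) = q := by
    rw [map_add, GradedAlgebra.proj_apply, GradedAlgebra.proj_apply,
      DirectSum.decompose_of_mem_ne _ hp (by norm_num), DirectSum.decompose_of_mem_same _ hq,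
      zero_add]
  rw [hproj]
  let c := Module.Basis.ofVectorSpace k V
  rw [tensorGrading_eq_wordSpan c] at hp hq
  obtain ⟨h, h'⟩ := exists_toGr_eq π c hq
  have hπ : π (p + q) = 0 := by
    rw [← TwoSidedIdeal.mem_ker, hA.ker_eq]
    exact TwoSidedIdeal.subset_span hf
  have h0 : symb (generators π) 2 ⟨π q, h⟩ = 0 := by
    rw [symb_eq_zero_iff, filtLT_eq_map_wordSpan π c]
    refine ⟨-p, neg_mem (wordSpan_mono (fun w hw => ?_) hp), ?_⟩
    · omega
    · rw [map_add] at hπ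
      simpa using (eq_neg_of_add_eq_zero_right hπ).symm
  rw [h', h0, map_zero]

lemma toGr_apply_eq_zero {m : ℕ} {f : TensorAlgebra k V}
    (hf : f ∈ wordSpan c fun w => w.length ≠ m) : toGr π f m = 0 := by
  have : (wordSpan c fun w => w.length ≠ m) ≤ LinearMap.ker
      (DirectSum.component k ℕ (GrComp (generators π)) m ∘ₗ (toGr π).toLinearMap) := by
    refine Submodule.span_le.2 ?_
    rintro _ ⟨w, hw, rfl⟩
    obtain ⟨h, h'⟩ := exists_toGr_wordBasis π c w
    change toGr π (wordBasis c w) m = 0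
    rw [h', DirectSum.of_eq_of_ne _ _ _ (Ne.symm hw)]
  exact this hf

end AssociatedGraded

/-! ### PBW algebras -/

section PBW

variable {k V A : Type*} [Field k] [AddCommGroup V] [Module k V] [Ring A] [Algebra k A]
  {π : TensorAlgebra k V →ₐ[k] A} {R : Submodule k (TensorAlgebra k V)} {n : ℕ}
  {c : Module.Basis (Fin n) k V} {G : Set (TensorAlgebra k V)}

/-- The homomorphism `A⁰ → gr A`. -/
def quadraticToGr (hA : IsAlmostQuadratic π R) : QuadraticAlg R →ₐ[k] Gr (generators π) :=
  (quadraticCon R).liftₐ (toGr π) (by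
    have h : TwoSidedIdeal.span (quadraticPart R : Set (TensorAlgebra k V)) ≤
        TwoSidedIdeal.ker (toGr π) := TwoSidedIdeal.span_le.2 fun q hq =>
      (TwoSidedIdeal.mem_ker _).2 (toGr_eq_zero_of_mem_quadraticPart hA hq)
    exact TwoSidedIdeal.ringCon_le_iff.1 h)

lemma quadraticToGr_mk (hA : IsAlmostQuadratic π R) (f : TensorAlgebra k V) :
    quadraticToGr hA ((quadraticCon R).mkₐ k f) = toGr π f := rfl

/-- A combination of normal words which vanishes in the associated graded algebra is zero. -/
lemma eq_zero_of_toGr_eq_zero (hA : IsAlmostQuadratic π R) (hGR : G ⊆ R)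
    (hG : IsGroebnerBasis c G (TwoSidedIdeal.span (R : Set (TensorAlgebra k V))))
    {f : TensorAlgebra k V} (hf : f ∈ wordSpan c (IsNormal (LeadingPair c R)))
    (h0 : toGr π f = 0) : f = 0 := by
  by_contra hne
  obtain ⟨w, hw⟩ := exists_isLeadingWord (c := c) hne
  have hw' := isLeadingWord_iff.1 hw
  set m := w.toList.length with hm
  obtain ⟨p, hp, q, hq, rfl⟩ := exists_add_of_mem_wordSpan (fun u => u.length = m) hf
  have hpm : p ∈ wordSpan c fun u => u.length = m := wordSpan_mono (fun u hu => hu.2) hp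
  have hqm : q ∈ wordSpan c fun u => u.length ≠ m := wordSpan_mono (fun u hu => hu.2) hq
  have hrepr : ∀ u : List (Fin n), u.length = m →
      (wordBasis c).repr (p + q) u = (wordBasis c).repr p u := fun u hu => by
    rw [map_add, Finsupp.add_apply, repr_eq_zero_of_mem_wordSpan hqm (by simpa using hu), add_zero]
  obtain ⟨h, h'⟩ := exists_toGr_eq π c hpm
  have hsymb : symb (generators π) m ⟨π p, h⟩ = 0 := by
    have := congrArg (fun y : Gr (generators π) => y m) h0
    simp only [map_add, DirectSum.add_apply, toGr_apply_eq_zero hqm, add_zero,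
      DirectSum.zero_apply] at this
    rwa [h', DirectSum.of_eq_same] at this
  rw [symb_eq_zero_iff, filtLT_eq_map_wordSpan π c] at hsymb
  obtain ⟨g, hg, hgp⟩ := hsymb
  have hI : p - g ∈ TwoSidedIdeal.span (R : Set (TensorAlgebra k V)) := by
    rw [← hA.ker_eq, TwoSidedIdeal.mem_ker, map_sub, sub_eq_zero]
    exact hgp.symm
  -- Subtracting `g` only changes coefficients of words shorter than `w`, so in the
  -- degree-lexicographical order `w` remains the greatest word.
  have hlead : IsLeadingWord c (p - g) w := by
    rw [isLeadingWord_iff]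
    refine ⟨?_, fun u hu hne => ?_⟩
    · rw [map_sub, Finsupp.sub_apply, repr_eq_zero_of_mem_wordSpan hg (by omega), sub_zero,
        ← hrepr _ rfl]
      exact hw'.1
    · by_cases hum : u.length < m
      · exact List.Shortlex.of_length_lt hum
      · rw [map_sub, Finsupp.sub_apply, repr_eq_zero_of_mem_wordSpan hg hum, sub_zero] at hu
        exact hw'.2 u (by rwa [hrepr u (mem_wordSpan_iff.1 hpm u hu)]) hne
  exact not_isNormal_of_isLeadingWord hA.le hA.inf_eq_bot hGR hG hI hlead
    (mem_wordSpan_iff.1 hf _ hw'.1)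

lemma map_wordSpan_eq_span {B : Type*} [Ring B] [Algebra k B] (φ : TensorAlgebra k V →ₐ[k] B)
    {S : Fin n → Fin n → Prop} (Q : List (Fin n) → Prop) :
    (wordSpan c fun u => IsNormal S u ∧ Q u).map φ.toLinearMap =
      Submodule.span k ((fun u : NormalWord S => φ (wordBasis c u.1)) '' {u | Q u.1}) := by
  rw [wordSpan, Submodule.map_span, Set.image_image]
  congr 1
  ext x
  constructor
  · rintro ⟨u, ⟨hu, hQ⟩, rfl⟩
    exact ⟨⟨u, hu⟩, hQ, rfl⟩
  · rintro ⟨u, hQ, rfl⟩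
    exact ⟨u.1, ⟨u.2, hQ⟩, rfl⟩

/-- Reduction to normal form stays within any `Q` closed under passing to smaller words of the same
length. Taking `Q` to be everything gives spanning, and taking a fixed length gives the grading. -/
lemma map_wordSpan_isNormal (hR : R ≤ tensorGrading k V 1 ⊔ tensorGrading k V 2)
    {Q : List (Fin n) → Prop} (hQ : ∀ w u, Q w → IsLower w u → Q u) :
    (wordSpan c fun u => IsNormal (LeadingPair c R) u ∧ Q u).map
        ((quadraticCon R).mkₐ k).toLinearMap =
      (wordSpan c Q).map ((quadraticCon R).mkₐ k).toLinearMap := by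
  refine le_antisymm (Submodule.map_mono (wordSpan_mono fun w hw => hw.2)) ?_
  rw [Submodule.map_le_iff_le_comap]
  refine Submodule.span_le.2 ?_
  rintro _ ⟨w, hw, rfl⟩
  refine Submodule.map_mono (wordSpan_mono ?_) (mk_mem_span_isLowerOrEq hR w)
  rintro u ⟨hu, rfl | hu'⟩
  exacts [⟨hu, hw⟩, ⟨hu, hQ _ _ hw hu'⟩]

lemma linearIndependent_toGr (hA : IsAlmostQuadratic π R) (hGR : G ⊆ R)
    (hG : IsGroebnerBasis c G (TwoSidedIdeal.span (R : Set (TensorAlgebra k V)))) :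
    LinearIndependent k fun w : NormalWord (LeadingPair c R) => toGr π (wordBasis c w.1) := by
  have h := (wordBasis c).linearIndependent.comp _
    (Subtype.val_injective : Function.Injective
      (Subtype.val : NormalWord (LeadingPair c R) → List (Fin n)))
  refine h.map (f := (toGr π).toLinearMap) ?_
  rw [Submodule.disjoint_def]
  intro f hf hf0
  refine eq_zero_of_toGr_eq_zero hA hGR hG ?_ hf0
  refine Submodule.span_mono ?_ hf
  rintro _ ⟨w, rfl⟩
  exact ⟨w.1, w.2, rfl⟩

/-- The basis of `A⁰` formed by the normal words. -/
def normalBasis (hA : IsAlmostQuadratic π R) (hGR : G ⊆ R)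
    (hG : IsGroebnerBasis c G (TwoSidedIdeal.span (R : Set (TensorAlgebra k V)))) :
    Module.Basis (NormalWord (LeadingPair c R)) k (QuadraticAlg R) :=
  Module.Basis.mk (v := fun w => (quadraticCon R).mkₐ k (wordBasis c w.1))
    -- Independence is pulled back from `gr A`, where the Gröbner property has been used.
    (LinearIndependent.of_comp (quadraticToGr hA).toLinearMap
      (linearIndependent_toGr hA hGR hG)) (by
    have h := map_wordSpan_eq_span (c := c) ((quadraticCon R).mkₐ k) (S := LeadingPair c R)
      fun _ => True
    rw [map_wordSpan_isNormal hA.le fun _ _ _ _ => trivial, wordSpan_true, Set.ofPred_true,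
      Set.image_univ] at h
    rw [← h, Submodule.map_top, LinearMap.range_eq_top.2 (RingCon.mkₐ_surjective (α := k) _)])

variable (hA : IsAlmostQuadratic π R) (hGR : G ⊆ R)
  (hG : IsGroebnerBasis c G (TwoSidedIdeal.span (R : Set (TensorAlgebra k V))))

lemma normalBasis_apply (w : NormalWord (LeadingPair c R)) :
    normalBasis hA hGR hG w = (quadraticCon R).mkₐ k (wordBasis c w.1) :=
  Module.Basis.mk_apply _ _ _

lemma isPBWBasis_normalBasis : IsPBWBasis (normalBasis hA hGR hG) where
  one := by rw [normalBasis_apply, emptyWord, wordBasis_nil, map_one]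
  mul_of_isNormal u v h := by
    rw [normalBasis_apply, normalBasis_apply, normalBasis_apply, ← map_mul, ← wordBasis_append]
  mul_of_not_isNormal u v h := by
    have h' := mk_mem_span_isLower hA.le h
    rw [map_wordSpan_eq_span, wordBasis_append, map_mul] at h'
    simpa only [normalBasis_apply, funext (normalBasis_apply hA hGR hG)] using h'

lemma lengthGrading_normalBasis :
    lengthGrading (normalBasis hA hGR hG) = quadraticGrading R := by
  funext m
  rw [quadraticGrading, tensorGrading_eq_wordSpan c, ← map_wordSpan_isNormal hA.le,
    map_wordSpan_eq_span, lengthGrading, funext (normalBasis_apply hA hGR hG)]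
  exact fun w u hw hu => hu.1.trans hw

lemma quadraticToGr_bijective (hGR : G ⊆ R)
    (hG : IsGroebnerBasis c G (TwoSidedIdeal.span (R : Set (TensorAlgebra k V)))) :
    Function.Bijective (quadraticToGr hA) := by
  constructor
  · rw [injective_iff_map_eq_zero]
    intro x hx
    have htop : x ∈ (wordSpan c fun _ => True).map ((quadraticCon R).mkₐ k).toLinearMap := by
      rw [wordSpan_true, Submodule.map_top]
      exact RingCon.mkₐ_surjective (α := k) _ x
    rw [← map_wordSpan_isNormal hA.le fun _ _ _ _ => trivial] at htop
    obtain ⟨f, hf, rfl⟩ := htop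
    rw [eq_zero_of_toGr_eq_zero hA hGR hG (wordSpan_mono (fun w hw => hw.1) hf) hx, map_zero]
  · intro y
    obtain ⟨f, rfl⟩ := toGr_surjective π y
    exact ⟨_, quadraticToGr_mk hA f⟩

/-- The isomorphism between `A⁰` and `gr A`. -/
def quadraticEquivGr (hGR : G ⊆ R)
    (hG : IsGroebnerBasis c G (TwoSidedIdeal.span (R : Set (TensorAlgebra k V)))) :
    QuadraticAlg R ≃ₐ[k] Gr (generators π) :=
  AlgEquiv.ofBijective (quadraticToGr hA) (quadraticToGr_bijective hA hGR hG)

lemma map_quadraticGrading (m : ℕ) :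
    (quadraticGrading R m).map (quadraticEquivGr hA hGR hG).toLinearMap =
      grGrading (generators π) m := by
  rw [quadraticGrading, ← Submodule.map_comp, ← map_tensorGrading_toGr]
  rfl

end PBW

end AlmostQuadratic

end

theorem mainTheorem3 {k V A : Type*} [Field k] [AddCommGroup V] [Module k V]
    [FiniteDimensional k V] [Ring A] [Algebra k A]
    (π : TensorAlgebra k V →ₐ[k] A) (R : Submodule k (TensorAlgebra k V))
    (hA : AlmostQuadratic.IsAlmostQuadratic π R) (hPBW : AlmostQuadratic.IsPBW R) :
    AlmostQuadratic.IsPriddyKoszul π R := by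
  open AlmostQuadratic in
  obtain ⟨n, c, m, r, hG⟩ := hPBW
  have hGR : (Set.range fun i => (r i : TensorAlgebra k V)) ⊆ R := by
    rintro _ ⟨i, rfl⟩
    exact (r i).2
  have hb := isPBWBasis_normalBasis hA hGR hG
  have hgrad := lengthGrading_normalBasis hA hGR hG
  refine ⟨⟨quadraticEquivGr hA hGR hG, map_quadraticGrading hA hGR hG⟩, hgrad ▸ hb.isKoszul, ?_⟩
  -- The isomorphism carries the PBW basis of `A⁰` to one of `gr A` with the correct grading, so the
  -- same criterion yields Koszulity of `gr A`.
  have h : lengthGrading ((normalBasis hA hGR hG).map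
      (quadraticEquivGr hA hGR hG).toLinearEquiv) = grGrading (generators π) := by
    funext m
    rw [lengthGrading_map, hgrad, map_quadraticGrading]
  exact h ▸ (hb.map (quadraticEquivGr hA hGR hG)).isKoszul
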